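/- Let $\mathbb F$ be a field and $V$ a nonzero finite-dimensional vector space over $\mathbb F$. A tridiagonal pair on $V$ is an ordered pair of diagonalizable linear maps $A,A^*:V\to V$ such that the eigenspaces of $A$ can be ordered as $V_0,\dots,V_d$ with $A^*V_i\subseteq V_{i-1}+V_i+V_{i+1}$, the eigenspaces of $A^*$ can be ordered as $V^*_0,\dots,V^*_\delta$ with $AV^*_i\subseteq V^*_{i-1}+V^*_i+V^*_{i+1}$ (where $V_{-1}=V_{d+1}=V^*_{-1}=V^*_{\delta+1}=0$), and no subspace other than $0$ and $V$ is invariant under both maps; such orderings are called standard. A tridiagonal system of diameter $d$ is a sequence $\Phi=(A;\{E_i\}_{i=0}^d;A^*;\{E^*_i\}_{i=0}^d)$, where $A,A^*$ is a tridiagonal pair and $\{E_i\}$, $\{E^*_i\}$ are the primitive idempotents of $A$, $A^*$, in orders for which $\{E_iV\}$, $\{E^*_iV\}$ are standard orderings of the eigenspaces. Let $\theta_i$, $\theta^*_i$ be the eigenvalues of $A$, $A^*$ on $E_iV$, $E^*_iV$. Call $\Phi$ sharp if $\dim E_0V=1$. Put $$\Phi^*=(A^*;\{E^*_i\};A;\{E_i\}),\quad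 \Phi^{\downarrow}=(A;\{E_i\};A^*;\{E^*_{d-i}\}),\quad \Phi^{\Downarrow}=(A;\{E_{d-i}\};A^*;\{E^*_i\});$$ these three involutions generate an action of the dihedral group $D_4$, and the relatives of $\Phi$ are the members of its orbit. A base of $\Phi$ is a scalar $\beta\in\mathbb F$ such that, if $d\ge 3$, $\beta+1$ is the common value of $\frac{\theta_{i-2}-\theta_{i+1}}{\theta_{i-1}-\theta_i}$ and $\frac{\theta^*_{i-2}-\theta^*_{i+1}}{\theta^*_{i-1}-\theta^*_i}$ for $2\le i\le d-1$; if $d\le 2$, any nonzero $\beta$ is allowed. The type is I if $\beta\ne\pm2$; IV if $\operatorname{char}\mathbb F=2$ and $\beta=0$; and, if $\operatorname{char}\mathbb F\neq 2$, II if $\beta=2$, III$^+$ if $\beta=-2$ and $d$ is even, III$^-$ if $\beta=-2$ and $d$ is odd. For $0\le i\le d$ let $\zeta_i$ be the eigenvalue on $U_0=E^*_0V\cap(E_0V+\cdots+E_dV)=E^*_0V$ of $$(A^*-\theta^*_1I)\cdots(A^*-\theta^*_iI)(A-\theta_{i-1}I)\cdots(A-\theta_0I).$$ The Drinfel'd polynomial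 $P\in\mathbb F[\lambda]$ of $\Phi$ (for the base $\beta$) is as follows. If the type is not III$^+$, then $$P=\sum_{i=0}^d\zeta_i\,p_{i+1}p_{i+2}\cdots p_d,\qquad p_i=(\theta_0\theta^*_d+\theta_d\theta^*_0-\lambda)\alpha_i+(\theta_0-\theta_i)(\theta^*_0-\theta^*_i),$$ where $\alpha_i=\frac{(q^i-q^{-i})^2}{(q^d-q^{-d})^2}$ with $q^2+q^{-2}=\beta$ for type I (this lies in $\mathbb F$), $\alpha_i=i^2/d^2$ for type II, and, for types III$^-$ and IV, $\alpha_i=0$ if $i$ is even and $\alpha_i=1$ if $i$ is odd. If the type is III$^+$, then $P=p_1p_2\cdots p_d$, where $p_i=(\theta_0\theta^*_d+\theta_d\theta^*_0-\lambda)i^2/d^2+(\theta_0-\theta_i)(\theta^*_0-\theta^*_i)$ for even $i$ and $p_i=\theta_0\theta^*_d+\theta_d\theta^*_0-\lambda$ for odd $i$. **Theorem.** Let $\Phi$ be a sharp tridiagonal system. Then a base of $\Phi$ exists; every relative of $\Phi$ is sharp, and its scalars $\zeta_i$ exist and are unique. For every base $\beta$ of $\Phi$, each relative $\Psi$ of $\Phi$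 also has base $\beta$, and the Drinfel'd polynomials of $\Psi$ and $\Phi$ for the base $\beta$ are equal. In other words, $P$ is $D_4$-invariant; in particular it is unchanged under $\Phi\mapsto\Phi^*$, $\Phi^{\downarrow}$, $\Phi^{\Downarrow}$. Consequently $P$ is an invariant of the tridiagonal pair: if $\Psi$ is any tridiagonal system on $V$ whose associated tridiagonal pair is $A,A^*$ or $A^*,A$, then $\Psi$ has diameter $d$, is sharp, has base $\beta$, and has the same Drinfel'd polynomial as $\Phi$ for the base $\beta$. -/

import Mathlib

open Polynomial

/-! ### Tridiagonal pairs -/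

/-- `W` is an eigenspace of `A`: a nonzero subspace `{v | A v = t v}` for some scalar `t`. -/
def IsEigenspace {F V : Type*} [Field F] [AddCommGroup V] [Module F V]
    (A : Module.End F V) (W : Submodule F V) : Prop :=
  W ≠ ⊥ ∧ ∃ t : F, W = A.eigenspace t

/-- `A` is diagonalizable: `V` is spanned by the eigenspaces of `A`. -/
def IsDiagonalizableEnd {F V : Type*} [Field F] [AddCommGroup V] [Module F V]
    (A : Module.End F V) : Prop :=
  sSup {W : Submodule F V | IsEigenspace A W} = ⊤

/-- `W 0, …, W d` is an ordering of the eigenspaces of `A` (each occurs exactly once). -/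
def IsEigenspaceOrdering {F V : Type*} [Field F] [AddCommGroup V] [Module F V] {d : ℕ}
    (A : Module.End F V) (W : Fin (d + 1) → Submodule F V) : Prop :=
  Function.Injective W ∧ ∀ U : Submodule F V, IsEigenspace A U ↔ ∃ i, W i = U

/-- `W 0, …, W d` is a standard ordering of the eigenspaces of `A`, relative to `B`:
`B (W i) ⊆ W (i-1) + W i + W (i+1)`, where `W (-1) = W (d+1) = 0`. -/
def IsStandardOrdering {F V : Type*} [Field F] [AddCommGroup V] [Module F V] {d : ℕ}
    (A B : Module.End F V) (W : Fin (d + 1) → Submodule F V) : Prop :=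
  IsEigenspaceOrdering A W ∧
    ∀ i : Fin (d + 1), (W i).map B ≤
      ⨆ j : {j : Fin (d + 1) // (j : ℕ) ≤ (i : ℕ) + 1 ∧ (i : ℕ) ≤ (j : ℕ) + 1}, W j

/-- `A, B` is a tridiagonal pair on `V` (`B` plays the role of `A*`). -/
structure IsTridiagonalPair {F V : Type*} [Field F] [AddCommGroup V] [Module F V]
    (A B : Module.End F V) : Prop where
  diag : IsDiagonalizableEnd A
  diag_star : IsDiagonalizableEnd B
  ordering : ∃ (d : ℕ) (W : Fin (d + 1) → Submodule F V), IsStandardOrdering A B W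
  ordering_star : ∃ (δ : ℕ) (W : Fin (δ + 1) → Submodule F V), IsStandardOrdering B A W
  irreducible : ∀ W : Submodule F V, W.map A ≤ W → W.map B ≤ W → W = ⊥ ∨ W = ⊤

/-! ### Tridiagonal systems -/

/-- `E 0, …, E d` is a standard ordering of the primitive idempotents of `A`, relative to `B`:
the spaces `E i V` form a standard ordering of the eigenspaces of `A`, and `E i` is the
identity on `E i V` and zero on `E j V` for `j ≠ i`. -/
structure IsStandardIdempotents {F V : Type*} [Field F] [AddCommGroup V] [Module F V] {d : ℕ}
    (A B : Module.End F V) (E : Fin (d + 1) → Module.End F V) : Prop where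
  standard : IsStandardOrdering A B (fun i => LinearMap.range (E i))
  apply_self : ∀ i, ∀ v ∈ LinearMap.range (E i), E i v = v
  apply_of_ne : ∀ i j, j ≠ i → ∀ v ∈ LinearMap.range (E j), E i v = 0

theorem IsStandardIdempotents.rev {F V : Type*} [Field F] [AddCommGroup V] [Module F V] {d : ℕ}
    {A B : Module.End F V} {E : Fin (d + 1) → Module.End F V}
    (h : IsStandardIdempotents A B E) :
    IsStandardIdempotents A B (fun i => E (Fin.rev i)) where
  standard := by
    obtain ⟨⟨hinj, hall⟩, htri⟩ := h.standard
    refine ⟨⟨fun i j hij => Fin.rev_injective (hinj hij), fun U => (hall U).trans ?_⟩,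
      fun i => (htri (Fin.rev i)).trans (iSup_le ?_)⟩
    · constructor
      · rintro ⟨i, hi⟩
        exact ⟨Fin.rev i, by simpa using hi⟩
      · rintro ⟨i, hi⟩
        exact ⟨Fin.rev i, hi⟩
    · rintro ⟨j, hj⟩
      have hj' : ((Fin.rev j : Fin (d + 1)) : ℕ) ≤ (i : ℕ) + 1 ∧
          (i : ℕ) ≤ ((Fin.rev j : Fin (d + 1)) : ℕ) + 1 := by
        have := i.isLt
        have := j.isLt
        simp only [Fin.val_rev] at hj ⊢
        omega
      refine le_trans ?_ (le_iSup (fun k : {k : Fin (d + 1) //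
        (k : ℕ) ≤ (i : ℕ) + 1 ∧ (i : ℕ) ≤ (k : ℕ) + 1} =>
          LinearMap.range (E (Fin.rev (k : Fin (d + 1))))) ⟨Fin.rev j, hj'⟩)
      simp
  apply_self i := h.apply_self (Fin.rev i)
  apply_of_ne i j hij := h.apply_of_ne _ _ (fun e => hij (Fin.rev_injective e))

theorem IsTridiagonalPair.symm {F V : Type*} [Field F] [AddCommGroup V] [Module F V]
    {A B : Module.End F V} (h : IsTridiagonalPair A B) : IsTridiagonalPair B A :=
  ⟨h.diag_star, h.diag, h.ordering_star, h.ordering, fun W hB hA => h.irreducible W hA hB⟩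

/-- A tridiagonal system `(A; {E i}; A*; {E* i})` on `V`, of diameter `d`. -/
structure TridiagonalSystem (F V : Type*) [Field F] [AddCommGroup V] [Module F V] (d : ℕ) where
  A : Module.End F V
  E : Fin (d + 1) → Module.End F V
  Astar : Module.End F V
  Estar : Fin (d + 1) → Module.End F V
  pair : IsTridiagonalPair A Astar
  standard : IsStandardIdempotents A Astar E
  standard_star : IsStandardIdempotents Astar A Estar

/-- The types of tridiagonal systems. -/
inductive TridiagonalType
  | I
  | II
  | IIIplus
  | IIIminus
  | IV

open Classical in
/-- The type attached to the diameter `d` and the base `β`. In the second case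
`β = 2 = -2 = 0`. -/
noncomputable def tridiagonalType {F : Type*} [Field F] (d : ℕ) (β : F) : TridiagonalType :=
  if β ≠ 2 ∧ β ≠ -2 then .I
  else if CharP F 2 then .IV
  else if β = 2 then .II
  else if Even d then .IIIplus
  else .IIIminus

/-- The polynomials `C n` satisfy `C n (x + x⁻¹) = x ^ n + x ^ (-n)`. Hence for
`β = q ^ 2 + q ^ (-2)` one has `C n (β) - 2 = (q ^ n - q ^ (-n)) ^ 2`. -/
theorem chebyshevC_eval_sub_two {K : Type*} [Field K] (q : K) (hq : q ≠ 0) (n : ℕ) :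
    (Chebyshev.C K n).eval (q ^ 2 + (q ^ 2)⁻¹) - 2 = (q ^ n - (q ^ n)⁻¹) ^ 2 := by
  have key : ∀ n : ℕ, (Chebyshev.C K n).eval (q ^ 2 + (q ^ 2)⁻¹) = (q ^ 2) ^ n + ((q ^ 2) ^ n)⁻¹ ∧
      (Chebyshev.C K ((n : ℤ) + 1)).eval (q ^ 2 + (q ^ 2)⁻¹) =
        (q ^ 2) ^ (n + 1) + ((q ^ 2) ^ (n + 1))⁻¹ := by
    intro n
    induction n with
    | zero => norm_num
    | succ n ih =>
      refine ⟨by exact_mod_cast ih.2, ?_⟩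
      have e : (((n + 1 : ℕ) : ℤ) + 1) = (n : ℤ) + 2 := by push_cast; ring
      rw [e, Chebyshev.C_add_two, eval_sub, eval_mul, eval_X, ih.1, ih.2]
      field_simp
      ring
  rw [(key n).1]
  field_simp
  ring

/-- The scalars `α i` of the Drinfel'd polynomial (not used for type `III⁺`). For type `I`
this is `(q ^ i - q ^ (-i)) ^ 2 / (q ^ d - q ^ (-d)) ^ 2` with `q ^ 2 + q ^ (-2) = β`, written
as a rational function of `β`; see `drinfeldAlpha_typeI`. -/
noncomputable def drinfeldAlpha {F : Type*} [Field F] (d : ℕ) (β : F) (i : ℕ) : F :=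
  match tridiagonalType d β with
  | .I => ((Chebyshev.C F i).eval β - 2) / ((Chebyshev.C F d).eval β - 2)
  | .II => (i : F) ^ 2 / (d : F) ^ 2
  | _ => if Even i then 0 else 1

theorem drinfeldAlpha_typeI {F : Type*} [Field F] (d : ℕ) (β : F) (i : ℕ)
    (hβ : tridiagonalType d β = .I) (q : AlgebraicClosure F) (hq : q ≠ 0)
    (hqβ : q ^ 2 + (q ^ 2)⁻¹ = algebraMap F (AlgebraicClosure F) β) :
    algebraMap F (AlgebraicClosure F) (drinfeldAlpha d β i) =
      (q ^ i - (q ^ i)⁻¹) ^ 2 / (q ^ d - (q ^ d)⁻¹) ^ 2 := by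
  have hmap : ∀ n : ℕ, algebraMap F (AlgebraicClosure F) ((Chebyshev.C F n).eval β - 2) =
      (q ^ n - (q ^ n)⁻¹) ^ 2 := by
    intro n
    rw [← chebyshevC_eval_sub_two q hq n, hqβ, map_sub, map_ofNat,
      ← Chebyshev.map_C (algebraMap F (AlgebraicClosure F)), eval_map_algebraMap,
      aeval_algebraMap_apply, coe_aeval_eq_eval]
  unfold drinfeldAlpha
  rw [hβ]
  simp only [map_div₀, hmap]

namespace TridiagonalSystem

/-- `Φ* = (A*; {E* i}; A; {E i})`. -/
def star {F V : Type*} [Field F] [AddCommGroup V] [Module F V] {d : ℕ}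
    (Φ : TridiagonalSystem F V d) : TridiagonalSystem F V d where
  A := Φ.Astar
  E := Φ.Estar
  Astar := Φ.A
  Estar := Φ.E
  pair := Φ.pair.symm
  standard := Φ.standard_star
  standard_star := Φ.standard

/-- `Φ^↓ = (A; {E i}; A*; {E* (d-i)})`. -/
def down {F V : Type*} [Field F] [AddCommGroup V] [Module F V] {d : ℕ}
    (Φ : TridiagonalSystem F V d) : TridiagonalSystem F V d where
  A := Φ.A
  E := Φ.E
  Astar := Φ.Astar
  Estar := fun i => Φ.Estar (Fin.rev i)
  pair := Φ.pair
  standard := Φ.standard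
  standard_star := Φ.standard_star.rev

/-- `Φ^⇓ = (A; {E (d-i)}; A*; {E* i})`. -/
def ddown {F V : Type*} [Field F] [AddCommGroup V] [Module F V] {d : ℕ}
    (Φ : TridiagonalSystem F V d) : TridiagonalSystem F V d where
  A := Φ.A
  E := fun i => Φ.E (Fin.rev i)
  Astar := Φ.Astar
  Estar := Φ.Estar
  pair := Φ.pair
  standard := Φ.standard.rev
  standard_star := Φ.standard_star

/-- `Φ.Relative Ψ`: the system `Ψ` lies in the orbit of `Φ` under the action of the dihedral
group `D₄` generated by the involutions `*`, `↓`, `⇓`. -/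
inductive Relative {F V : Type*} [Field F] [AddCommGroup V] [Module F V] {d : ℕ}
    (Φ : TridiagonalSystem F V d) : TridiagonalSystem F V d → Prop
  | refl : Relative Φ Φ
  | star {Ψ : TridiagonalSystem F V d} : Relative Φ Ψ → Relative Φ Ψ.star
  | down {Ψ : TridiagonalSystem F V d} : Relative Φ Ψ → Relative Φ Ψ.down
  | ddown {Ψ : TridiagonalSystem F V d} : Relative Φ Ψ → Relative Φ Ψ.ddown

theorem exists_eigenvalue {F V : Type*} [Field F] [AddCommGroup V] [Module F V] {d : ℕ}
    (Φ : TridiagonalSystem F V d) (i : Fin (d + 1)) :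
    ∃ t : F, LinearMap.range (Φ.E i) = Φ.A.eigenspace t :=
  ((Φ.standard.standard.1.2 _).2 ⟨i, rfl⟩).2

/-- The eigenvalue `θ i` of `A` associated with the eigenspace `E i V`. -/
noncomputable def eigenvalue {F V : Type*} [Field F] [AddCommGroup V] [Module F V] {d : ℕ}
    (Φ : TridiagonalSystem F V d) (i : Fin (d + 1)) : F :=
  (Φ.exists_eigenvalue i).choose

theorem range_eq_eigenspace {F V : Type*} [Field F] [AddCommGroup V] [Module F V] {d : ℕ}
    (Φ : TridiagonalSystem F V d) (i : Fin (d + 1)) :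
    LinearMap.range (Φ.E i) = Φ.A.eigenspace (Φ.eigenvalue i) :=
  (Φ.exists_eigenvalue i).choose_spec

/-- The eigenvalue `θ* i` of `A*` associated with the eigenspace `E* i V`. -/
noncomputable def dualEigenvalue {F V : Type*} [Field F] [AddCommGroup V] [Module F V] {d : ℕ}
    (Φ : TridiagonalSystem F V d) (i : Fin (d + 1)) : F :=
  Φ.star.eigenvalue i

/-- `Φ` is sharp: the eigenspace `E 0 V` has dimension one. -/
def IsSharp {F V : Type*} [Field F] [AddCommGroup V] [Module F V] {d : ℕ}
    (Φ : TridiagonalSystem F V d) : Prop :=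
  Module.finrank F (LinearMap.range (Φ.E 0)) = 1

/-- `β` is a base of `Φ`. For `d ≥ 3`, `β + 1` is the common value of
`(θ (i-2) - θ (i+1)) / (θ (i-1) - θ i)` and `(θ* (i-2) - θ* (i+1)) / (θ* (i-1) - θ* i)` for
`2 ≤ i ≤ d - 1` (below `i - 2` is called `k`). For `d ≤ 2`, `β` is any nonzero scalar. -/
def IsBase {F V : Type*} [Field F] [AddCommGroup V] [Module F V] {d : ℕ}
    (Φ : TridiagonalSystem F V d) (β : F) : Prop :=
  (∀ (k : ℕ) (hk : k + 3 ≤ d),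
    (Φ.eigenvalue ⟨k, by omega⟩ - Φ.eigenvalue ⟨k + 3, by omega⟩) /
        (Φ.eigenvalue ⟨k + 1, by omega⟩ - Φ.eigenvalue ⟨k + 2, by omega⟩) = β + 1 ∧
    (Φ.dualEigenvalue ⟨k, by omega⟩ - Φ.dualEigenvalue ⟨k + 3, by omega⟩) /
        (Φ.dualEigenvalue ⟨k + 1, by omega⟩ - Φ.dualEigenvalue ⟨k + 2, by omega⟩) = β + 1) ∧
  (d ≤ 2 → β ≠ 0)

/-- The component `U i = (E* 0 V + ⋯ + E* i V) ∩ (E i V + ⋯ + E d V)` of the split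
decomposition. -/
def splitSpace {F V : Type*} [Field F] [AddCommGroup V] [Module F V] {d : ℕ}
    (Φ : TridiagonalSystem F V d) (i : Fin (d + 1)) : Submodule F V :=
  (⨆ j : Set.Iic i, LinearMap.range (Φ.Estar j)) ⊓ (⨆ j : Set.Ici i, LinearMap.range (Φ.E j))

/-- The linear map `(A* - θ* 1) ⋯ (A* - θ* i) (A - θ (i-1)) ⋯ (A - θ 0)`. -/
noncomputable def splitMap {F V : Type*} [Field F] [AddCommGroup V] [Module F V] {d : ℕ}
    (Φ : TridiagonalSystem F V d) (i : Fin (d + 1)) : Module.End F V :=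
  aeval Φ.Astar (∏ j ∈ Finset.Ioc 0 i, (X - C (Φ.dualEigenvalue j))) *
    aeval Φ.A (∏ j ∈ Finset.Iio i, (X - C (Φ.eigenvalue j)))

/-- `ζ` is the split sequence of `Φ`: for each `i` the space `U 0` is invariant under
`splitMap i`, with eigenvalue `ζ i`. -/
def IsSplitSequence {F V : Type*} [Field F] [AddCommGroup V] [Module F V] {d : ℕ}
    (Φ : TridiagonalSystem F V d) (ζ : Fin (d + 1) → F) : Prop :=
  ∀ i, ∀ u ∈ Φ.splitSpace 0, Φ.splitMap i u = ζ i • u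

/-- The split sequence of `Φ`. -/
noncomputable def splitSeq {F V : Type*} [Field F] [AddCommGroup V] [Module F V] {d : ℕ}
    (Φ : TridiagonalSystem F V d) : Fin (d + 1) → F :=
  Classical.epsilon Φ.IsSplitSequence

/-- The polynomial `p i` for all types other than `III⁺`. -/
noncomputable def drinfeldFactor {F V : Type*} [Field F] [AddCommGroup V] [Module F V] {d : ℕ}
    (Φ : TridiagonalSystem F V d) (β : F) (i : Fin (d + 1)) : F[X] :=
  (C (Φ.eigenvalue 0 * Φ.dualEigenvalue (Fin.last d) +
      Φ.eigenvalue (Fin.last d) * Φ.dualEigenvalue 0) - X) * C (drinfeldAlpha d β i) +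
    C ((Φ.eigenvalue 0 - Φ.eigenvalue i) * (Φ.dualEigenvalue 0 - Φ.dualEigenvalue i))

/-- The polynomial `p i` for type `III⁺`. -/
noncomputable def drinfeldFactorIIIplus {F V : Type*} [Field F] [AddCommGroup V] [Module F V]
    {d : ℕ} (Φ : TridiagonalSystem F V d) (i : Fin (d + 1)) : F[X] :=
  if Even (i : ℕ) then
    (C (Φ.eigenvalue 0 * Φ.dualEigenvalue (Fin.last d) +
        Φ.eigenvalue (Fin.last d) * Φ.dualEigenvalue 0) - X) *
        C (((i : ℕ) : F) ^ 2 / (d : F) ^ 2) +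
      C ((Φ.eigenvalue 0 - Φ.eigenvalue i) * (Φ.dualEigenvalue 0 - Φ.dualEigenvalue i))
  else
    C (Φ.eigenvalue 0 * Φ.dualEigenvalue (Fin.last d) +
      Φ.eigenvalue (Fin.last d) * Φ.dualEigenvalue 0) - X

/-- The Drinfel'd polynomial of `Φ` with base `β`: `p 1 ⋯ p d` for type `III⁺`, and
`∑ i, ζ i p (i+1) ⋯ p d` otherwise. -/
noncomputable def drinfeldPoly {F V : Type*} [Field F] [AddCommGroup V] [Module F V] {d : ℕ}
    (Φ : TridiagonalSystem F V d) (β : F) : F[X] :=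
  match tridiagonalType d β with
  | .IIIplus => ∏ i ∈ Finset.Ioi (0 : Fin (d + 1)), Φ.drinfeldFactorIIIplus i
  | _ => ∑ i : Fin (d + 1), C (Φ.splitSeq i) * ∏ j ∈ Finset.Ioi i, Φ.drinfeldFactor β j

end TridiagonalSystem

/-! Since `↓` equals `* ⇓ *`, it is enough to follow sharpness, the base and P under `*` and `⇓`.

Sharpness and the base: irreducibility makes `E 0` a bijection from E*₀V onto E₀V
(`finrank_range_zero`), so sharpness passes to the dual. For d ≥ 3 there is a polynomial f with
A²A*A - AA*A² = f(A)A* - A*f(A); it turns out to be cubic, with leading coefficient 1/(β + 1) for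
the common base β (`exists_base`).

Invariance under `*`: the factors p_i are visibly self-dual. The split sequences of the system and
its dual agree because both can be read off from E₀τ*_i(A*)τ_i(A)E*₀, where τ_i and τ*_i are the
monic polynomials with roots θ₀, …, θ_{i-1} and θ*₀, …, θ*_{i-1} (`splitMap_eigenvalue_dual`).

Invariance under `⇓`: as E*₀V is a line, E*₀E_jE*₀ = m_jE*₀ for scalars m_j. Each ζ_i is linear in
the m_j (`splitSeq_eq`), so up to a nonzero constant P is the sum of m_j times `drinfeldSum` at θ_j
(`drinfeldPoly_eq_sum`). Reversing the order of the E_j only reindexes the m_j, so the claim reduces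
to one identity for each j: `drinfeldSum` at θ_j does not change when the sequence θ is reversed
(`drinfeldSum_reverse`).

That identity is polynomial in β, the initial values of θ and θ*, and λ. For generic complex
parameters the eigenvalues have the form a + bwⁿ + cw⁻ⁿ, and a summation formula of Saalschütz type
turns both sides into the same product. Genericity is then removed by passing to ℤ[X₀, …, X₇] and
specializing to any commutative ring, which settles types I, II, III⁻ and IV together. In type III⁺
the common denominator of the α_i vanishes, but there P is an explicit product whose symmetry is
apparent (`drinfeldPoly_IIIplus`).

Finally, a standard ordering is unique up to reversal (`E_eq_or_eq_rev`), so systems with the same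
pair are relatives. -/

/-! ### The linear recurrence of the eigenvalues. -/

/-- The solution of the recurrence `s n - s (n + 3) = (β + 1) (s (n + 1) - s (n + 2))` with
initial values `a`, `b`, `c`. -/
def recSeq {R : Type*} [CommRing R] (β a b c : R) : ℕ → R
  | 0 => a
  | 1 => b
  | 2 => c
  | n + 3 => recSeq β a b c n - (β + 1) * (recSeq β a b c (n + 1) - recSeq β a b c (n + 2))

theorem map_recSeq {R S : Type*} [CommRing R] [CommRing S] (f : R →+* S) (β a b c : R) (n : ℕ) :
    f (recSeq β a b c n) = recSeq (f β) (f a) (f b) (f c) n := by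
  induction n using recSeq.induct with
  | case1 => simp [recSeq]
  | case2 => simp [recSeq]
  | case3 => simp [recSeq]
  | case4 n h1 h2 h3 => simp [recSeq, h1, h2, h3]

theorem eq_recSeq {R : Type*} [CommRing R] (β : R) (s : ℕ → R) (d : ℕ)
    (hs : ∀ k, k + 3 ≤ d → s k - s (k + 3) = (β + 1) * (s (k + 1) - s (k + 2)))
    (n : ℕ) (hn : n ≤ d) : s n = recSeq β (s 0) (s 1) (s 2) n := by
  induction n using recSeq.induct with
  | case1 => simp [recSeq]
  | case2 => simp [recSeq]
  | case3 => simp [recSeq]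
  | case4 n h1 h2 h3 =>
    rw [recSeq, ← h1 (by omega), ← h2 (by omega), ← h3 (by omega), ← hs n hn]
    ring

/-- The characteristic polynomial of the recurrence is (x - 1)(x² - βx + 1), with roots 1, w, w⁻¹;
these are distinct when w ≠ ±1. -/
theorem exists_recSeq_eq {K : Type*} [Field K] {w : K} (hw : w ≠ 0) (h1 : w ≠ 1) (h2 : w ≠ -1)
    (x y z : K) : ∃ a b c : K, ∀ n, recSeq (w + w⁻¹) x y z n = a + b * w ^ n + c * (w ^ n)⁻¹ := by
  have e1 : w - 1 ≠ 0 := sub_ne_zero.2 h1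
  have e2 : w + 1 ≠ 0 := fun h => h2 (eq_neg_of_add_eq_zero_left h)
  -- The first differences are combinations of wⁿ and w⁻ⁿ; `b` and `c` are solved from y - x and z -
  -- y.
  let b : K := (z - y - w⁻¹ * (y - x)) / ((w - 1) * (w - w⁻¹))
  have e3 : w ^ 2 - 1 ≠ 0 := by
    have : w ^ 2 - 1 = (w - 1) * (w + 1) := by ring
    rw [this]; exact mul_ne_zero e1 e2
  have e4 : w - w⁻¹ ≠ 0 := by
    have : w - w⁻¹ = (w ^ 2 - 1) / w := by field_simp
    rw [this]; exact div_ne_zero e3 hw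
  let c : K := (z - y - w * (y - x)) / ((w⁻¹ - 1) * (w⁻¹ - w))
  have e5 : w⁻¹ - 1 ≠ 0 := fun h => h1 (by
    have := sub_eq_zero.1 h
    rwa [inv_eq_one] at this)
  have e6 : w⁻¹ - w ≠ 0 := fun h => e4 (by rw [← neg_sub, h, neg_zero])
  have hb : b * ((w - 1) * (w - w⁻¹)) = z - y - w⁻¹ * (y - x) :=
    div_mul_cancel₀ _ (mul_ne_zero e1 e4)
  have hc : c * ((w⁻¹ - 1) * (w⁻¹ - w)) = z - y - w * (y - x) :=
    div_mul_cancel₀ _ (mul_ne_zero e5 e6)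
  clear_value b c
  have hyx : y - x = b * (w - 1) + c * (w⁻¹ - 1) := by
    have : (w - w⁻¹) * (y - x) = (w - w⁻¹) * (b * (w - 1) + c * (w⁻¹ - 1)) := by
      linear_combination hc - hb
    exact mul_left_cancel₀ e4 this
  have hzy : z - y = b * (w ^ 2 - w) + c * (w⁻¹ ^ 2 - w⁻¹) := by
    have : z - y = b * ((w - 1) * (w - w⁻¹)) + w⁻¹ * (y - x) := by rw [hb]; ring
    rw [this, hyx]
    field_simp
    ring
  refine ⟨x - b - c, b, c, fun n => ?_⟩
  induction n using recSeq.induct with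
  | case1 => simp [recSeq]; ring
  | case2 => simp only [recSeq, pow_one]; linear_combination hyx
  | case3 => simp only [recSeq, ← inv_pow]; linear_combination hyx + hzy
  | case4 n h1 h2 h3 =>
    rw [recSeq, h1, h2, h3, Nat.succ_eq_add_one]
    field_simp
    ring

/-! ### One step of the Saalschütz-type summation, by telescoping. -/

section Telescoping

variable {K : Type*} [Field K]

/-- A summation formula of Saalschütz type, in the form of a first order recurrence. -/
theorem saalschuetz_step {w a b c b' c' s : K} (hw : w ≠ 0) (hw1 : w ≠ 1) {j : ℕ}
    (θ ν κ : ℕ → K)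
    (hθ : ∀ n, θ n = a + b * w ^ n + c * (w ^ n)⁻¹)
    (hν : ∀ n, ν n = b' - c' * (w ^ n)⁻¹)
    (hκ : ∀ n, κ n = (w ^ n - 1) / (w ^ n * ν n))
    (hν0 : ∀ n, 1 ≤ n → n ≤ j + 1 → ν n ≠ 0)
    (hwn : ∀ n, 1 ≤ n → n ≤ j + 1 → w ^ n ≠ 1)
    (hμ : b - c * (w ^ j)⁻¹ ≠ 0) :
    (∑ i ∈ Finset.range (j + 2), (∏ k ∈ Finset.range i, (θ (j + 1) - θ k)) *
        ∏ k ∈ Finset.Ico i (j + 1), (θ 0 - θ (k + 1) + s * κ (k + 1))) =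
      (κ (j + 1) * s + (θ 0 - θ (j + 1)) + κ (j + 1) / κ 1 * (θ (j + 1) - θ j)) *
      ∑ i ∈ Finset.range (j + 1), (∏ k ∈ Finset.range i, (θ j - θ k)) *
        ∏ k ∈ Finset.Ico i j, (θ 0 - θ (k + 1) + s * κ (k + 1)) := by
  set L := (κ (j + 1) * s + (θ 0 - θ (j + 1)) + κ (j + 1) / κ 1 * (θ (j + 1) - θ j)) with hL
  set g : ℕ → K := fun k => θ 0 - θ (k + 1) + s * κ (k + 1) with hg
  let μ : ℕ → K := fun n => b - c * (w ^ n)⁻¹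
  -- The telescoping certificate: summed up to i = n, the differences (term for j + 1) - L · (term
  -- for j) give `e n` times the n-th term for j.
  let e : ℕ → K := fun n =>
    -κ (j + 1) * ν (n + 1) * w ^ (n + 1 + j) * μ (2 * j + 1) * μ (j + n) / μ j
  have hL' : L = κ (j + 1) * s + (θ 0 - θ (j + 1)) +
      κ (j + 1) * w * ν 1 / (w - 1) * (θ (j + 1) - θ j) := by
    rw [hL, hκ 1, pow_one]
    have := sub_ne_zero.2 hw1
    have := hν0 1 le_rfl (by omega)
    field_simp
  have hτ : ∀ i, (∏ k ∈ Finset.range (i + 1), (θ (j + 1) - θ k)) * μ j =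
      (∏ k ∈ Finset.range i, (θ j - θ k)) * (w ^ i * (w ^ (j + 1) - 1) * μ (j + i) *
        μ (j + i + 1)) := by
    intro i
    induction i with
    | zero =>
      simp only [zero_add, Finset.prod_range_one, Finset.prod_range_zero, hθ, μ]
      field_simp
      ring
    | succ i ih =>
      rw [Finset.prod_range_succ, mul_right_comm, ih, Finset.prod_range_succ]
      simp only [hθ, μ]
      field_simp
      ring
  have hsum : ∀ n, n ≤ j → ∑ i ∈ Finset.range (n + 1),
      ((∏ k ∈ Finset.range i, (θ (j + 1) - θ k)) * (∏ k ∈ Finset.Ico i (j + 1), g k) -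
        L * ((∏ k ∈ Finset.range i, (θ j - θ k)) * ∏ k ∈ Finset.Ico i j, g k)) =
      e n * ((∏ k ∈ Finset.range n, (θ j - θ k)) * ∏ k ∈ Finset.Ico n j, g k) := by
    intro n hn
    have hνj : ν (j + 1) ≠ 0 := hν0 _ (by omega) le_rfl
    have hwj : w ^ (j + 1) - 1 ≠ 0 := sub_ne_zero.2 (hwn _ (by omega) le_rfl)
    have hw1' := sub_ne_zero.2 hw1
    have hκν : ∀ n, 1 ≤ n → n ≤ j + 1 → ν n * κ n = 1 - (w ^ n)⁻¹ := by
      intro n h1 h2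
      rw [hκ]
      have := hν0 n h1 h2
      field_simp
    -- The induction step of `hsum` freed of products and powers, with J = w ^ j, I = w ^ n and κj =
    -- `κ (j + 1)`.
    have hcore : ∀ (J I κj : K), J ≠ 0 → I ≠ 0 → J * w - 1 = κj * (b' * (J * w) - c') →
        (I * (J * w - 1) * (b - c * (J * I)⁻¹) * (b - c * (J * I * w)⁻¹)) *
        (b + c - b * (J * w) - c * (J * w)⁻¹ + s * κj) -
        (κj * s + (b + c - b * (J * w) - c * (J * w)⁻¹) + κj * w * (b' - c' * w⁻¹) *
          (b * J - c * (J * w)⁻¹)) *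
          ((J - I) * (b - c * (J * I)⁻¹) * (b - c * J⁻¹))
        = -κj * (b' - c' * (I * w * w)⁻¹) * (I * w * w * J) * (b - c * (J * J * w)⁻¹)
            * (b - c * (J * I * w)⁻¹) * ((J - I) * (b - c * (J * I)⁻¹)) +
          κj * (b' - c' * (I * w)⁻¹) * (I * w * J) * (b - c * (J * J * w)⁻¹) *
            (b - c * (J * I)⁻¹) * (b + c - b * (I * w) - c * (I * w)⁻¹) +
          κj * s * (1 - (I * w)⁻¹) * (I * w * J) * (b - c * (J * J * w)⁻¹) *
            (b - c * (J * I)⁻¹) := by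
      intro J I κj hJ hI e3
      rw [← sub_eq_zero] at e3 ⊢
      -- The difference of the two sides is an explicit multiple of the relation `e3`, the only fact
      -- about κj that is needed.
      refine Eq.trans ?_ (mul_eq_zero_of_right (-((b - c * (J * I)⁻¹) * (b - c * (J * J * w)⁻¹) *
        J * (I * w - 1) * (b - c * (J * w)⁻¹))) e3)
      field_simp
      ring
    induction n with
    | zero =>
      simp only [zero_add, Finset.sum_range_one, Finset.prod_range_zero, one_mul]
      rw [Finset.prod_Ico_succ_top (by omega), hL']
      have : g j - (κ (j + 1) * s + (θ 0 - θ (j + 1)) +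
        κ (j + 1) * w * ν 1 / (w - 1) * (θ (j + 1) - θ j)) = e 0 := by
        have e4 : e 0 = -κ (j + 1) * ν 1 * w ^ (1 + j) * μ (2 * j + 1) :=
          mul_div_cancel_right₀ _ hμ
        rw [e4]
        simp only [hg, hθ, μ]
        field_simp
        ring
      linear_combination (∏ k ∈ Finset.Ico 0 j, g k) * this
    | succ n ih =>
      rw [Finset.sum_range_succ, ih (by omega)]
      have hP1 : ∏ k ∈ Finset.Ico n j, g k = g n * ∏ k ∈ Finset.Ico (n + 1) j, g k :=
        Finset.prod_eq_prod_Ico_succ_bot (by omega) _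
      have hP2 : ∏ k ∈ Finset.Ico (n + 1) (j + 1), g k = (∏ k ∈ Finset.Ico (n + 1) j, g k) * g j :=
        Finset.prod_Ico_succ_top (by omega) _
      have hτn : (∏ k ∈ Finset.range (n + 1), (θ (j + 1) - θ k)) =
          (∏ k ∈ Finset.range n, (θ j - θ k)) * (w ^ n * (w ^ (j + 1) - 1) * μ (j + n) *
        μ (j + n + 1)) / μ j := eq_div_of_mul_eq hμ (hτ n)
      rw [hP1, hP2, hτn, Finset.prod_range_succ]
      have key : (w ^ n * (w ^ (j + 1) - 1) * μ (j + n) * μ (j + n + 1)) / μ j * g j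
          - L * (θ j - θ n) = e (n + 1) * (θ j - θ n) - e n * g n := by
        have h1 := hcore (w ^ j) (w ^ n) (κ (j + 1)) (pow_ne_zero _ hw) (pow_ne_zero _ hw) (by
          have h2 := hκν (j + 1) (by omega) le_rfl
          rw [hν, pow_succ] at h2
          field_simp at h2
          linear_combination -h2)
        have he : ∀ n, e n * μ j =
            -κ (j + 1) * ν (n + 1) * w ^ (n + 1 + j) * μ (2 * j + 1) * μ (j + n) :=
          fun n => div_mul_cancel₀ _ hμ
        have hn' : e n * g n * μ j = (e n * μ j) * (θ 0 - θ (n + 1)) -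
            s * (ν (n + 1) * κ (n + 1)) * (κ (j + 1) * w ^ (n + 1 + j) *
              μ (2 * j + 1) * μ (j + n)) := by
          simp only [hg]; linear_combination (s * κ (n + 1)) * he n
        rw [hκν _ (by omega) (by omega), he] at hn'
        have hX := div_mul_cancel₀ (w ^ n * (w ^ (j + 1) - 1) * μ (j + n) * μ (j + n + 1)) hμ
        have hs1 : κ (j + 1) * w * ν 1 / (w - 1) * (θ (j + 1) - θ j) =
            κ (j + 1) * w * ν 1 * (b * w ^ j - c * (w ^ j * w)⁻¹) := by
          simp only [hθ]; field_simp; ring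
        have hs2 : θ j - θ n = (w ^ j - w ^ n) * (b - c * (w ^ j * w ^ n)⁻¹) := by
          simp only [hθ]; field_simp; ring
        have hs3 : ∀ n, θ 0 - θ (n + 1) = b + c - b * (w ^ n * w) - c * (w ^ n * w)⁻¹ := by
          intro n; simp only [hθ]; field_simp; ring
        have p1 : w ^ (n + 1 + j) = w ^ n * w * w ^ j := by ring
        have p2 : w ^ (n + 1 + 1 + j) = w ^ n * w * w * w ^ j := by ring
        have p3 : w ^ (2 * j + 1) = w ^ j * w ^ j * w := by ring
        have p4 : w ^ (j + n + 1) = w ^ j * w ^ n * w := by ring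
        have p5 : w ^ (j + n) = w ^ j * w ^ n := by ring
        have p6 : w ^ (j + 1) = w ^ j * w := by ring
        have p7 : w ^ (n + 1) = w ^ n * w := by ring
        have p8 : w ^ (n + 1 + 1) = w ^ n * w * w := by ring
        have he1 := he (n + 1)
        have hgj : g j = (b + c - b * (w ^ j * w) - c * (w ^ j * w)⁻¹ + s * κ (j + 1)) := by
          simp only [hg, hs3]
        rw [hL', hs1, hs3, hs2, hgj]
        refine mul_right_cancel₀ hμ ?_
        simp only [μ, hs3, hν, ← add_assoc, p1, p2, p3, p4, p5, p6, p7, p8, pow_one]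
          at h1 hX he1 hn' ⊢
        linear_combination h1 + (b + c - b * (w ^ j * w) - c * (w ^ j * w)⁻¹ + s * κ (j + 1)) * hX
          - ((w ^ j - w ^ n) * (b - c * (w ^ j * w ^ n)⁻¹)) * he1 + hn'
      linear_combination ((∏ k ∈ Finset.range n, (θ j - θ k)) *
        ∏ k ∈ Finset.Ico (n + 1) j, g k) * key
  have hfin := hsum j le_rfl
  rw [Finset.sum_sub_distrib, ← Finset.mul_sum] at hfin
  -- The sum for j + 1 has one term more, i = j + 1, which cancels what `e j` leaves over.
  rw [Finset.sum_range_succ, sub_eq_iff_eq_add'.1 hfin]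
  have hτj : (∏ k ∈ Finset.range (j + 1), (θ (j + 1) - θ k)) =
          (∏ k ∈ Finset.range j, (θ j - θ k)) * (w ^ j * (w ^ (j + 1) - 1) * μ (j + j) *
        μ (j + j + 1)) / μ j := eq_div_of_mul_eq hμ (hτ j)
  rw [hτj]
  have hνj : ν (j + 1) ≠ 0 := hν0 _ (by omega) le_rfl
  have : (w ^ j * (w ^ (j + 1) - 1) * μ (j + j) * μ (j + j + 1)) / μ j + e j = 0 := by
    have e5 : w ^ (j + 1 + j) * (-κ (j + 1) * ν (j + 1)) + w ^ j * (w ^ (j + 1) - 1) = 0 := by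
      rw [hκ]
      field_simp
      ring
    simp only [e, two_mul]
    rw [← add_div, div_eq_zero_iff]
    left
    linear_combination (μ (j + j) * μ (j + j + 1)) * e5
  simp only [Finset.Ico_self, Finset.prod_empty, mul_one]
  linear_combination (∏ k ∈ Finset.range j, (θ j - θ k)) * this

end Telescoping

/-! ### The sum as a product, and its behaviour under reversal. -/

section Summation

variable {K : Type*} [Field K]

/-- `saalschuetz_step` is iterated, with its multiplier rewritten (`hL`) as a ratio of κ's times a
factor of the same kind for the reversed sequence with shifted `s`. -/
theorem saalschuetz_sum {w a b c b' c' s : K} (hw : w ≠ 0) {d : ℕ} (θ ν κ : ℕ → K)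
    (hθ : ∀ n, θ n = a + b * w ^ n + c * (w ^ n)⁻¹)
    (hν : ∀ n, ν n = b' - c' * (w ^ n)⁻¹)
    (hκ : ∀ n, κ n = (w ^ n - 1) / (w ^ n * ν n))
    (hν0 : ∀ n, 1 ≤ n → n ≤ d → ν n ≠ 0)
    (hwn : ∀ n, 1 ≤ n → n ≤ d → w ^ n ≠ 1)
    (hμ : ∀ n, 1 ≤ n → n < d → b - c * (w ^ n)⁻¹ ≠ 0) (j : ℕ) (hj : j ≤ d) :
    (∑ i ∈ Finset.range (j + 1), (∏ k ∈ Finset.range i, (θ j - θ k)) *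
        ∏ k ∈ Finset.Ico i j, (θ 0 - θ (k + 1) + s * κ (k + 1))) =
      ∏ m ∈ Finset.range j, (κ (m + 1) / κ (d - m) *
        (θ d - θ m + (s - w ^ d * ν d * (b - c * (w ^ d)⁻¹)) * κ (d - m))) := by
  induction j with
  | zero => simp
  | succ j ih =>
    have hstep : ∀ n, 1 ≤ n → n ≤ d → κ n ≠ 0 := fun n h1 h2 => by
      rw [hκ]
      exact div_ne_zero (sub_ne_zero.2 (hwn n h1 h2)) (mul_ne_zero (pow_ne_zero _ hw) (hν0 n h1 h2))
    rw [Finset.prod_range_succ, ← ih (by omega), mul_comm]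
    have hL : κ (j + 1) / κ (d - j) *
        (θ d - θ j + (s - w ^ d * ν d * (b - c * (w ^ d)⁻¹)) * κ (d - j)) =
        κ (j + 1) * s + (θ 0 - θ (j + 1)) + κ (j + 1) / κ 1 * (θ (j + 1) - θ j) := by
      obtain ⟨m, rfl⟩ : ∃ m, d = j + (m + 1) := ⟨d - j - 1, by omega⟩
      rw [Nat.add_sub_cancel_left]
      have e1 : (κ (m + 1))⁻¹ = w ^ (m + 1) * ν (m + 1) / (w ^ (m + 1) - 1) := by
        rw [hκ, inv_div]
      have e2 : (κ 1)⁻¹ = w * ν 1 / (w - 1) := by rw [hκ, inv_div, pow_one]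
      have e3 : κ (j + 1) * ν (j + 1) * w ^ (j + 1) = w ^ (j + 1) - 1 := by
        rw [hκ]
        have := hν0 (j + 1) (by omega) (by omega)
        field_simp
      have e4 : κ (m + 1) ≠ 0 := hstep _ (by omega) (by omega)
      have e5 : w ^ (m + 1) - 1 ≠ 0 := sub_ne_zero.2 (hwn _ (by omega) (by omega))
      have e6 : w - 1 ≠ 0 := by
        have := sub_ne_zero.2 (hwn 1 le_rfl (by omega)); rwa [pow_one] at this
      have e7 : θ 0 - θ (j + 1) = -κ (j + 1) * ν (j + 1) * w ^ (j + 1) *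
          (b - c * (w ^ (j + 1))⁻¹) := by
        rw [neg_mul, neg_mul, e3, hθ, hθ]
        field_simp
        ring
      have e8 : (κ (m + 1))⁻¹ * (θ (j + (m + 1)) - θ j) =
          w ^ (m + 1) * ν (m + 1) * (b * w ^ j - c * (w ^ (j + (m + 1)))⁻¹) := by
        rw [e1, hθ, hθ, pow_add w j (m + 1)]
        have hW0 : w ^ (m + 1) ≠ 0 := pow_ne_zero _ hw
        generalize w ^ (m + 1) = W at e5 hW0 ⊢
        field_simp
        ring
      have e9 : (κ 1)⁻¹ * (θ (j + 1) - θ j) = w * ν 1 * (b * w ^ j - c * (w ^ (j + 1))⁻¹) := by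
        rw [e2, hθ, hθ]
        field_simp
        ring
      have e10 : κ (j + 1) / κ (m + 1) * (θ (j + (m + 1)) - θ j +
          (s - w ^ (j + (m + 1)) * ν (j + (m + 1)) * (b - c * (w ^ (j + (m + 1)))⁻¹)) * κ (m + 1)) =
          κ (j + 1) * ((κ (m + 1))⁻¹ * (θ (j + (m + 1)) - θ j) + s -
            w ^ (j + (m + 1)) * ν (j + (m + 1)) * (b - c * (w ^ (j + (m + 1)))⁻¹)) := by
        field_simp
        ring
      rw [e10, e8, div_mul_eq_mul_div, mul_div_assoc, div_eq_inv_mul (θ (j + 1) - θ j), e9, e7,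
        hν, hν, hν, hν]
      generalize κ (j + 1) = k
      field_simp
      ring
    rw [hL]
    -- The step from 0 to 1 is computed directly: `saalschuetz_step` at j = 0 would require b ≠ c,
    -- which is not assumed.
    rcases Nat.eq_zero_or_pos j with rfl | hj0
    · have := hstep 1 le_rfl hj
      simp [Finset.sum_range_succ]
      field_simp
      ring
    · have h1 : w ≠ 1 := by simpa using hwn 1 le_rfl (by omega)
      exact saalschuetz_step hw h1 θ ν κ hθ hν hκ (fun n h1 h2 => hν0 n h1 (by omega))
        (fun n h1 h2 => hwn n h1 (by omega)) (hμ j hj0 (by omega))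

/-- For i > j the first product contains θ j - θ j. -/
theorem sum_range_prod_truncate {R : Type*} [CommRing R] (θ g : ℕ → R) {d j : ℕ} (hj : j ≤ d) :
    (∑ i ∈ Finset.range (d + 1), (∏ k ∈ Finset.range i, (θ j - θ k)) * ∏ k ∈ Finset.Ico i d, g k) =
      (∑ i ∈ Finset.range (j + 1), (∏ k ∈ Finset.range i, (θ j - θ k)) *
        ∏ k ∈ Finset.Ico i j, g k) * ∏ k ∈ Finset.Ico j d, g k := by
  rw [Finset.sum_mul]
  symm
  refine Finset.sum_subset_zero_on_sdiff (Finset.range_mono (by omega)) ?_ ?_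
  · intro i hi
    simp only [Finset.mem_sdiff, Finset.mem_range] at hi
    rw [Finset.prod_eq_zero (i := j) (Finset.mem_range.2 (by omega)) (sub_self _), zero_mul]
  · intro i hi
    rw [Finset.mem_range] at hi
    rw [mul_assoc, Finset.prod_Ico_consecutive _ (by omega) hj]

theorem prod_range_sub_eq_prod_Ico {M : Type*} [CommMonoid M] (f : ℕ → M) {d j : ℕ} (hj : j ≤ d) :
    ∏ m ∈ Finset.range j, f (d - 1 - m) = ∏ k ∈ Finset.Ico (d - j) d, f k := by
  cases d with
  | zero =>
    obtain rfl : j = 0 := by omega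
    simp
  | succ n => rw [Finset.range_eq_Ico, Nat.add_sub_cancel, Finset.prod_Ico_reflect f 0 hj, Nat.sub_zero]

/-- The left sum stops at j and the right one at d - j, and `saalschuetz_sum` evaluates both. The
factors produced by either evaluation are those split off in truncating the other sum; the remaining
ratios of κ's agree by cancellation. -/
theorem saalschuetz_reversal {w a b c b' c' s : K} (hw : w ≠ 0) {d : ℕ} (θ ν κ : ℕ → K)
    (hθ : ∀ n, θ n = a + b * w ^ n + c * (w ^ n)⁻¹)
    (hν : ∀ n, ν n = b' - c' * (w ^ n)⁻¹)
    (hκ : ∀ n, κ n = (w ^ n - 1) / (w ^ n * ν n))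
    (hν0 : ∀ n, 1 ≤ n → n ≤ d → ν n ≠ 0)
    (hwn : ∀ n, 1 ≤ n → n ≤ d → w ^ n ≠ 1)
    (hμ : ∀ n, 1 ≤ n → n + 1 ≤ 2 * d → b - c * (w ^ n)⁻¹ ≠ 0) (j : ℕ) (hj : j ≤ d) :
    (∑ i ∈ Finset.range (d + 1), (∏ k ∈ Finset.range i, (θ j - θ k)) *
        ∏ k ∈ Finset.Ico i d, (θ 0 - θ (k + 1) + s * κ (k + 1))) =
      ∑ i ∈ Finset.range (d + 1), (∏ k ∈ Finset.range i, (θ j - θ (d - k))) *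
        ∏ k ∈ Finset.Ico i d, (θ d - θ (d - (k + 1)) +
          (s - w ^ d * ν d * (b - c * (w ^ d)⁻¹)) * κ (k + 1)) := by
  have hκ0 : ∀ n, 1 ≤ n → n ≤ d → κ n ≠ 0 := fun n h1 h2 => by
    rw [hκ]
    exact div_ne_zero (sub_ne_zero.2 (hwn n h1 h2)) (mul_ne_zero (pow_ne_zero _ hw) (hν0 n h1 h2))
  set s' := s - w ^ d * ν d * (b - c * (w ^ d)⁻¹) with hs'
  -- The reversed sequence has the same shape, with the roles of `b` and `c` exchanged.
  let θ' : ℕ → K := fun n => a + (c * (w ^ d)⁻¹) * w ^ n + (b * w ^ d) * (w ^ n)⁻¹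
  have hθ' : ∀ n, n ≤ d → θ' n = θ (d - n) := by
    intro n hn
    obtain ⟨m, rfl⟩ := Nat.exists_eq_add_of_le' hn
    simp only [θ', hθ, Nat.add_sub_cancel]
    field_simp
    ring
  -- Shifting `s'` by the data of the reversed sequence gives back `s`.
  have hs'' : s' - w ^ d * ν d * (c * (w ^ d)⁻¹ - b * w ^ d * (w ^ d)⁻¹) = s := by
    rw [hs']
    field_simp
    ring
  have h1 := saalschuetz_sum (s := s) hw θ ν κ hθ hν hκ hν0 hwn
    (fun n h1 h2 => hμ n h1 (by omega)) j hj
  -- For `θ'` the nonvanishing condition at n is, up to a unit, the one for `θ` at 2 * d - n; this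
  -- is why `hμ` ranges up to 2d - 1.
  have h2 := saalschuetz_sum (s := s') hw θ' ν κ (fun _ => rfl) hν hκ hν0 hwn (by
    intro n h1 h2 h3
    refine hμ (2 * d - n) (by omega) (by omega) ?_
    obtain ⟨m, rfl⟩ : ∃ m, d = n + m := ⟨d - n, by omega⟩
    rw [show 2 * (n + m) - n = n + 2 * m by omega]
    rw [sub_eq_zero] at h3 ⊢
    field_simp at h3 ⊢
    refine mul_left_cancel₀ (pow_ne_zero n hw) ?_
    rw [mul_comm _ c, h3]
    ring) (d - j) (by omega)
  rw [hs''] at h2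
  have hR : (∑ i ∈ Finset.range (d + 1), (∏ k ∈ Finset.range i, (θ j - θ (d - k))) *
        ∏ k ∈ Finset.Ico i d, (θ d - θ (d - (k + 1)) + s' * κ (k + 1))) =
      ∑ i ∈ Finset.range (d + 1), (∏ k ∈ Finset.range i, (θ' (d - j) - θ' k)) *
        ∏ k ∈ Finset.Ico i d, (θ' 0 - θ' (k + 1) + s' * κ (k + 1)) := by
    refine Finset.sum_congr rfl fun i hi => ?_
    rw [Finset.mem_range] at hi
    congr 1
    · refine Finset.prod_congr rfl fun k hk => ?_
      rw [Finset.mem_range] at hk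
      rw [hθ' _ (by omega), hθ' _ (by omega), Nat.sub_sub_self hj]
    · refine Finset.prod_congr rfl fun k hk => ?_
      rw [Finset.mem_Ico] at hk
      rw [hθ' _ (by omega), hθ' _ (by omega), Nat.sub_zero]
  rw [hR, sum_range_prod_truncate θ _ hj, sum_range_prod_truncate θ' _ (Nat.sub_le d j), h1, h2,
    Finset.prod_mul_distrib, Finset.prod_mul_distrib]
  have hA : ∏ m ∈ Finset.range j, (θ d - θ m + s' * κ (d - m)) =
      ∏ k ∈ Finset.Ico (d - j) d, (θ' 0 - θ' (k + 1) + s' * κ (k + 1)) := by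
    rw [← prod_range_sub_eq_prod_Ico _ hj]
    refine Finset.prod_congr rfl fun m hm => ?_
    rw [Finset.mem_range] at hm
    rw [hθ' _ (by omega), hθ' _ (by omega), show d - 1 - m + 1 = d - m by omega, Nat.sub_zero,
      Nat.sub_sub_self (by omega : m ≤ d)]
  have hB : ∏ m ∈ Finset.range (d - j), (θ' d - θ' m + s * κ (d - m)) =
      ∏ k ∈ Finset.Ico j d, (θ 0 - θ (k + 1) + s * κ (k + 1)) := by
    have := prod_range_sub_eq_prod_Ico (fun k => θ 0 - θ (k + 1) + s * κ (k + 1)) (Nat.sub_le d j)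
    rw [Nat.sub_sub_self hj] at this
    rw [← this]
    refine Finset.prod_congr rfl fun m hm => ?_
    rw [Finset.mem_range] at hm
    rw [hθ' _ le_rfl, hθ' _ (by omega), show d - 1 - m + 1 = d - m by omega, Nat.sub_self]
  have hC : ∏ m ∈ Finset.range j, (κ (m + 1) / κ (d - m)) =
      ∏ m ∈ Finset.range (d - j), (κ (m + 1) / κ (d - m)) := by
    have hr : ∀ i, i ≤ d → ∏ m ∈ Finset.range i, κ (d - m) =
        ∏ k ∈ Finset.Ico (d - i) d, κ (k + 1) := by
      intro i hi
      rw [← prod_range_sub_eq_prod_Ico _ hi]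
      refine Finset.prod_congr rfl fun m hm => ?_
      rw [Finset.mem_range] at hm
      rw [show d - 1 - m + 1 = d - m by omega]
    have hn : ∀ i, ∏ k ∈ Finset.Ico i d, κ (k + 1) ≠ 0 := by
      intro i
      refine Finset.prod_ne_zero_iff.2 fun k hk => ?_
      rw [Finset.mem_Ico] at hk
      exact hκ0 _ (by omega) (by omega)
    rw [Finset.prod_div_distrib, Finset.prod_div_distrib, hr _ hj, hr _ (Nat.sub_le d j),
      Nat.sub_sub_self hj, div_eq_div_iff (hn _) (hn _), Finset.prod_range_mul_prod_Ico _ hj,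
      Finset.prod_range_mul_prod_Ico _ (Nat.sub_le d j)]
  rw [hA, hB, hC]
  ring

end Summation

/-! ### The reversal identity over an arbitrary commutative ring. -/

/-- The sum defining the Drinfel'd polynomial, with the denominators of the scalars `α i`
cleared and `τ i (x)` in place of the split sequence. -/
def drinfeldSum {R : Type*} [CommRing R] (d : ℕ) (θ σ S : ℕ → R) (z x : R) : R :=
  ∑ i ∈ Finset.range (d + 1), (∏ k ∈ Finset.range i, (x - θ k)) *
    (∏ k ∈ Finset.range i, (S d * (σ 0 - σ (k + 1)))) *
    ∏ k ∈ Finset.Ico i d, ((θ 0 * σ d + θ d * σ 0 - z) * S (k + 1) +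
      S d * ((θ 0 - θ (k + 1)) * (σ 0 - σ (k + 1))))

theorem map_drinfeldSum {R T : Type*} [CommRing R] [CommRing T] (f : R →+* T) (d : ℕ)
    (θ σ S : ℕ → R) (z x : R) :
    f (drinfeldSum d θ σ S z x) =
      drinfeldSum d (fun k => f (θ k)) (fun k => f (σ k)) (fun k => f (S k)) (f z) (f x) := by
  simp [drinfeldSum, map_sum, map_prod]

theorem drinfeldSum_congr {R : Type*} [CommRing R] {d : ℕ} {θ θ' σ σ' S S' : ℕ → R} {z x : R}
    (h1 : ∀ k ≤ d, θ k = θ' k) (h2 : ∀ k ≤ d, σ k = σ' k) (h3 : ∀ k ≤ d, S k = S' k) :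
    drinfeldSum d θ σ S z x = drinfeldSum d θ' σ' S' z x := by
  unfold drinfeldSum
  refine Finset.sum_congr rfl fun i hi => ?_
  rw [Finset.mem_range] at hi
  refine congrArg₂ _ (congrArg₂ _ (Finset.prod_congr rfl fun k hk => ?_)
    (Finset.prod_congr rfl fun k hk => ?_)) (Finset.prod_congr rfl fun k hk => ?_)
  · rw [Finset.mem_range] at hk
    rw [h1 k (by omega)]
  · rw [Finset.mem_range] at hk
    rw [h3 d le_rfl, h2 0 (by omega), h2 (k + 1) (by omega)]
  · rw [Finset.mem_Ico] at hk
    rw [h1 0 (by omega), h1 d le_rfl, h1 (k + 1) (by omega), h2 0 (by omega), h2 d le_rfl,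
      h2 (k + 1) (by omega), h3 d le_rfl, h3 (k + 1) (by omega)]

theorem exists_add_inv_eq {K : Type*} [Field K] [IsAlgClosed K] (β : K) :
    ∃ w : K, w ≠ 0 ∧ w + w⁻¹ = β := by
  obtain ⟨w, hw⟩ := IsAlgClosed.exists_root (X ^ 2 - C β * X + 1 : K[X]) (by
    have : (X ^ 2 - C β * X + 1 : K[X]).degree = 2 := by compute_degree!
    rw [this]; decide)
  have h : w ^ 2 - β * w + 1 = 0 := by simpa [IsRoot] using hw
  have h0 : w ≠ 0 := by rintro rfl; simp at h
  refine ⟨w, h0, ?_⟩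
  field_simp
  linear_combination h

theorem add_inv_ne {K : Type*} [Field K] {w β : K} (h : w + w⁻¹ = β) (hβ : β ^ 2 ≠ 4) :
    w ≠ 1 ∧ w ≠ -1 := by
  constructor
  · rintro rfl
    apply hβ
    rw [← h, inv_one]
    norm_num
  · rintro rfl
    apply hβ
    rw [← h, inv_neg, inv_one]
    norm_num

/-- With w = q² the right side is ((qⁿ - q⁻ⁿ)/(q - q⁻¹))², the numerator of αₙ in type I up to a
constant. -/
theorem recSeq_square {K : Type*} [Field K] {w : K} (hw : w ≠ 0) (h1 : w ≠ 1) (n : ℕ) :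
    recSeq (w + w⁻¹) 0 1 (w + w⁻¹ + 2) n = w / (w - 1) ^ 2 * ((w ^ n - 1) ^ 2 / w ^ n) := by
  have h1' := sub_ne_zero.2 h1
  induction n using recSeq.induct with
  | case1 => simp [recSeq]
  | case2 => simp only [recSeq, pow_one]; field_simp
  | case3 => simp only [recSeq]; field_simp; ring
  | case4 n h1 h2 h3 =>
    rw [recSeq, h1, h2, h3, Nat.succ_eq_add_one]
    field_simp
    ring

/-- Since σ 0 - σ k = (1 - w ^ k) ν k, the quotient S k / (σ 0 - σ k) is a constant times `κ k`.
Dividing the factor S d (σ 0 - σ k) out of every term leaves the sums compared in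
`saalschuetz_reversal`. -/
theorem drinfeldSum_reverse_of_generic {K : Type*} [Field K] [IsAlgClosed K] {d : ℕ}
    (β t₀ t₁ t₂ u₀ u₁ u₂ z : K) (hβ : β ^ 2 ≠ 4)
    (hθ : ∀ i j, i ≤ d → j ≤ d → i ≠ j → recSeq β t₀ t₁ t₂ i ≠ recSeq β t₀ t₁ t₂ j)
    (hσ : ∀ k, 1 ≤ k → k ≤ d → recSeq β u₀ u₁ u₂ 0 ≠ recSeq β u₀ u₁ u₂ k) (j : ℕ) (hj : j ≤ d) :
    drinfeldSum d (recSeq β t₀ t₁ t₂) (recSeq β u₀ u₁ u₂) (recSeq β 0 1 (β + 2)) z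
        (recSeq β t₀ t₁ t₂ j) =
      drinfeldSum d (fun k => recSeq β t₀ t₁ t₂ (d - k)) (recSeq β u₀ u₁ u₂)
        (recSeq β 0 1 (β + 2)) z (recSeq β t₀ t₁ t₂ j) := by
  rcases Nat.eq_zero_or_pos d with rfl | hd
  · simp [drinfeldSum]
  obtain ⟨w, hw, rfl⟩ := exists_add_inv_eq β
  obtain ⟨h1, h2⟩ := add_inv_ne rfl hβ
  have h1' := sub_ne_zero.2 h1
  obtain ⟨a, b, c, hs⟩ := exists_recSeq_eq hw h1 h2 t₀ t₁ t₂
  obtain ⟨a', b', c', hs'⟩ := exists_recSeq_eq hw h1 h2 u₀ u₁ u₂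
  have hS := recSeq_square hw h1
  generalize recSeq (w + w⁻¹) t₀ t₁ t₂ = θ at *
  generalize recSeq (w + w⁻¹) u₀ u₁ u₂ = σ at *
  generalize recSeq (w + w⁻¹) 0 1 (w + w⁻¹ + 2) = S at *
  let ν : ℕ → K := fun n => b' - c' * (w ^ n)⁻¹
  let κ : ℕ → K := fun n => (w ^ n - 1) / (w ^ n * ν n)
  have hσν : ∀ n, σ 0 - σ n = (1 - w ^ n) * ν n := by
    intro n
    simp only [hs', ν]
    field_simp
    ring
  have hν0 : ∀ n, 1 ≤ n → n ≤ d → ν n ≠ 0 := fun n h1 h2 h =>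
    hσ n h1 h2 (sub_eq_zero.1 (by rw [hσν, h, mul_zero]))
  have hwn : ∀ n, 1 ≤ n → n ≤ d → w ^ n ≠ 1 := fun n h1 h2 h =>
    hσ n h1 h2 (sub_eq_zero.1 (by rw [hσν, h, sub_self, zero_mul]))
  have hθμ : ∀ i j, θ i - θ j = (w ^ i - w ^ j) * (b - c * (w ^ (i + j))⁻¹) := by
    intro i j
    simp only [hs]
    field_simp
    ring
  have hμ : ∀ n, 1 ≤ n → n + 1 ≤ 2 * d → b - c * (w ^ n)⁻¹ ≠ 0 := by
    intro n h1 h2 h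
    by_cases hn : n ≤ d
    · exact hθ n 0 hn (by omega) (by omega)
        (sub_eq_zero.1 (by rw [hθμ, Nat.add_zero, h, mul_zero]))
    · exact hθ (n - d) d (by omega) (by omega) (by omega)
        (sub_eq_zero.1 (by rw [hθμ, Nat.sub_add_cancel (by omega), h, mul_zero]))
  have hSd : S d ≠ 0 := by
    rw [hS]
    have := sub_ne_zero.2 (hwn d hd le_rfl)
    positivity
  -- The value for which the k-th factor becomes S d (σ 0 - σ k) (θ 0 - θ k + s κ k).
  set s : K := -(θ 0 * σ d + θ d * σ 0 - z) * (w / (w - 1) ^ 2) / S d with hsdef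
  have key := saalschuetz_reversal (s := s) hw θ ν κ hs (fun _ => rfl) (fun _ => rfl) hν0 hwn hμ j hj
  have hκ : ∀ k, 1 ≤ k → k ≤ d → ∀ x : K, x * S k =
      S d * ((σ 0 - σ k) * ((-x * (w / (w - 1) ^ 2) / S d) * κ k)) := by
    intro k h1 h2 x
    have := hν0 k h1 h2
    rw [hσν]
    simp only [κ]
    rw [show S d * ((1 - w ^ k) * ν k * (-x * (w / (w - 1) ^ 2) / S d *
      ((w ^ k - 1) / (w ^ k * ν k)))) = (1 - w ^ k) * (-x * (w / (w - 1) ^ 2) *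
      ((w ^ k - 1) / w ^ k)) by field_simp, hS]
    field_simp
    ring
  have hfac : ∀ (η : ℕ → K), drinfeldSum d η σ S z (θ j) =
      (∏ k ∈ Finset.range d, (S d * (σ 0 - σ (k + 1)))) *
      ∑ i ∈ Finset.range (d + 1), (∏ k ∈ Finset.range i, (θ j - η k)) *
        ∏ k ∈ Finset.Ico i d, (η 0 - η (k + 1) +
          (-(η 0 * σ d + η d * σ 0 - z) * (w / (w - 1) ^ 2) / S d) * κ (k + 1)) := by
    intro η
    rw [drinfeldSum, Finset.mul_sum]
    refine Finset.sum_congr rfl fun i hi => ?_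
    rw [Finset.mem_range] at hi
    rw [← Finset.prod_range_mul_prod_Ico _ (by omega : i ≤ d)]
    have : ∏ k ∈ Finset.Ico i d, ((η 0 * σ d + η d * σ 0 - z) * S (k + 1) +
        S d * ((η 0 - η (k + 1)) * (σ 0 - σ (k + 1)))) =
        (∏ k ∈ Finset.Ico i d, (S d * (σ 0 - σ (k + 1)))) *
        ∏ k ∈ Finset.Ico i d, (η 0 - η (k + 1) +
          (-(η 0 * σ d + η d * σ 0 - z) * (w / (w - 1) ^ 2) / S d) * κ (k + 1)) := by
      rw [← Finset.prod_mul_distrib]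
      refine Finset.prod_congr rfl fun k hk => ?_
      rw [Finset.mem_Ico] at hk
      rw [hκ (k + 1) (by omega) (by omega)]
      ring
    rw [this]
    ring
  rw [hfac, hfac]
  congr 1
  rw [← hsdef, key]
  -- The shift of `s` under reversal is the effect of exchanging θ 0 and θ d in θ 0 σ d + θ d σ 0:
  -- the difference is (θ d - θ 0)(σ d - σ 0).
  have hs2 : s - w ^ d * ν d * (b - c * (w ^ d)⁻¹) =
      -(θ (d - 0) * σ d + θ (d - d) * σ 0 - z) * (w / (w - 1) ^ 2) / S d := by
    have e1 : (w ^ d * ν d * (b - c * (w ^ d)⁻¹)) * S d =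
        (θ d - θ 0) * (σ d - σ 0) * (w / (w - 1) ^ 2) := by
      rw [hθμ, ← neg_sub (σ 0), hσν, hS, Nat.add_zero, pow_zero]
      generalize b - c * (w ^ d)⁻¹ = M
      generalize ν d = N
      field_simp
      ring
    rw [hsdef, Nat.sub_zero, Nat.sub_self, eq_div_iff hSd, sub_mul, div_mul_cancel₀ _ hSd, e1]
    ring
  rw [hs2]
  rfl

theorem recSeq_four (n : ℕ) : recSeq (17 / 4 : ℂ) 1 4 16 n = 4 ^ n := by
  induction n using recSeq.induct with
  | case1 => simp [recSeq]
  | case2 => simp [recSeq]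
  | case3 => norm_num [recSeq]
  | case4 n h1 h2 h3 =>
    rw [recSeq, h1, h2, h3, Nat.succ_eq_add_one]
    ring

/-- D (P - Q) vanishes at every point, hence is zero. -/
theorem MvPolynomial.eq_of_forall_eval_ne_zero {ι : Type*} (D P Q : MvPolynomial ι ℂ)
    (hD : D ≠ 0) (h : ∀ v : ι → ℂ, MvPolynomial.eval v D ≠ 0 →
      MvPolynomial.eval v P = MvPolynomial.eval v Q) : P = Q := by
  have h0 : D * (P - Q) = 0 := by
    refine MvPolynomial.funext fun v => ?_
    by_cases hv : MvPolynomial.eval v D = 0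
    · simp [hv]
    · simp [h v hv]
  exact sub_eq_zero.1 ((mul_eq_zero.1 h0).resolve_left hD)

/-- The sum `drinfeldSum` at the point `θ j`, as a function of the eight free parameters. -/
def reversalLeft {R : Type*} [CommRing R] (d j : ℕ) (v : Fin 8 → R) : R :=
  drinfeldSum d (recSeq (v 0) (v 1) (v 2) (v 3)) (recSeq (v 0) (v 4) (v 5) (v 6))
    (recSeq (v 0) 0 1 (v 0 + 2)) (v 7) (recSeq (v 0) (v 1) (v 2) (v 3) j)

/-- The counterpart of `reversalLeft` for the reversed sequence `θ d, …, θ 0`. -/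
def reversalRight {R : Type*} [CommRing R] (d j : ℕ) (v : Fin 8 → R) : R :=
  drinfeldSum d (fun k => recSeq (v 0) (v 1) (v 2) (v 3) (d - k))
    (recSeq (v 0) (v 4) (v 5) (v 6))
    (recSeq (v 0) 0 1 (v 0 + 2)) (v 7) (recSeq (v 0) (v 1) (v 2) (v 3) j)

theorem map_reversalLeft {R S : Type*} [CommRing R] [CommRing S] (f : R →+* S) (d j : ℕ)
    (v : Fin 8 → R) : f (reversalLeft d j v) = reversalLeft d j (fun i => f (v i)) := by
  simp only [reversalLeft, map_drinfeldSum, map_recSeq, map_zero, map_one, map_add, map_ofNat]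

theorem map_reversalRight {R S : Type*} [CommRing R] [CommRing S] (f : R →+* S) (d j : ℕ)
    (v : Fin 8 → R) : f (reversalRight d j v) = reversalRight d j (fun i => f (v i)) := by
  simp only [reversalRight, map_drinfeldSum, map_recSeq, map_zero, map_one, map_add, map_ofNat]

theorem reversalLeft_eq_reversalRight_X {d j : ℕ} (hj : j ≤ d) :
    reversalLeft d j (MvPolynomial.X : Fin 8 → MvPolynomial (Fin 8) ℂ) =
      reversalRight d j MvPolynomial.X := by
  let Y : Fin 8 → MvPolynomial (Fin 8) ℂ := MvPolynomial.X
  -- Off the zeros of `D` the parameters satisfy the hypotheses of `drinfeldSum_reverse_of_generic`.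
  let D : MvPolynomial (Fin 8) ℂ := (Y 0 ^ 2 - 4) *
    (∏ p ∈ (Finset.range (d + 1) ×ˢ Finset.range (d + 1)).filter (fun p => p.1 ≠ p.2),
      (recSeq (Y 0) (Y 1) (Y 2) (Y 3) p.1 - recSeq (Y 0) (Y 1) (Y 2) (Y 3) p.2)) *
    ∏ k ∈ Finset.Icc 1 d,
      (recSeq (Y 0) (Y 4) (Y 5) (Y 6) 0 - recSeq (Y 0) (Y 4) (Y 5) (Y 6) k)
  have hDeval : ∀ v, MvPolynomial.eval v D = (v 0 ^ 2 - 4) *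
    (∏ p ∈ (Finset.range (d + 1) ×ˢ Finset.range (d + 1)).filter (fun p => p.1 ≠ p.2),
      (recSeq (v 0) (v 1) (v 2) (v 3) p.1 - recSeq (v 0) (v 1) (v 2) (v 3) p.2)) *
    ∏ k ∈ Finset.Icc 1 d,
      (recSeq (v 0) (v 4) (v 5) (v 6) 0 - recSeq (v 0) (v 4) (v 5) (v 6) k) := by
    intro v
    simp only [D, Y, map_mul, map_prod, map_sub, map_pow, map_recSeq, MvPolynomial.eval_X, map_ofNat]
  have h4 : Function.Injective fun n : ℕ => (4 : ℂ) ^ n := by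
    intro a b h
    have h' : (4 : ℂ) ^ a = 4 ^ b := h
    exact Nat.pow_right_injective (by norm_num : 2 ≤ 4) (by exact_mod_cast h')
  refine MvPolynomial.eq_of_forall_eval_ne_zero D _ _ (fun hD => ?_) fun v hv => ?_
  -- `D` is not zero: for β = 4 + 1/4 both sequences can be 4ⁿ, whose terms are distinct.
  · have h := hDeval ![17 / 4, 1, 4, 16, 1, 4, 16, 0]
    rw [hD, map_zero] at h
    refine absurd h.symm ?_
    simp only [Fin.isValue, Matrix.cons_val, recSeq_four]
    refine mul_ne_zero (mul_ne_zero (by norm_num) (Finset.prod_ne_zero_iff.2 fun p hp => ?_))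
      (Finset.prod_ne_zero_iff.2 fun k hk => ?_)
    · exact sub_ne_zero.2 (h4.ne (Finset.mem_filter.1 hp).2)
    · rw [Finset.mem_Icc] at hk
      exact sub_ne_zero.2 (h4.ne (by omega))
  · rw [hDeval] at hv
    obtain ⟨hv', h3⟩ := mul_ne_zero_iff.1 hv
    obtain ⟨h1, h2⟩ := mul_ne_zero_iff.1 hv'
    rw [Finset.prod_ne_zero_iff] at h2 h3
    rw [map_reversalLeft, map_reversalRight]
    simp only [MvPolynomial.eval_X]
    refine drinfeldSum_reverse_of_generic _ _ _ _ _ _ _ _ (sub_ne_zero.1 h1) ?_ ?_ j hj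
    · intro a b ha hb hab
      refine sub_ne_zero.1 (h2 (a, b) ?_)
      simp only [Finset.mem_filter, Finset.mem_product, Finset.mem_range]
      exact ⟨⟨by omega, by omega⟩, hab⟩
    · intro k h1 h2
      exact sub_ne_zero.1 (h3 k (Finset.mem_Icc.2 ⟨h1, h2⟩))

/-- Both sides are universal polynomials with integer coefficients, so the identity over ℂ descends
to ℤ and then specializes, also to β = ±2 and to positive characteristic. -/
theorem reversalLeft_eq_reversalRight {R : Type*} [CommRing R] {d j : ℕ} (hj : j ≤ d)
    (v : Fin 8 → R) : reversalLeft d j v = reversalRight d j v := by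
  have h : reversalLeft d j (MvPolynomial.X : Fin 8 → MvPolynomial (Fin 8) ℤ) =
      reversalRight d j MvPolynomial.X := by
    apply MvPolynomial.map_injective (Int.castRingHom ℂ) Int.cast_injective
    rw [map_reversalLeft, map_reversalRight]
    simp only [MvPolynomial.map_X]
    exact reversalLeft_eq_reversalRight_X hj
  have := congrArg (MvPolynomial.eval₂Hom (Int.castRingHom R) v) h
  rw [map_reversalLeft, map_reversalRight] at this
  simpa only [MvPolynomial.eval₂Hom_X'] using this

/-- The reversal identity behind the invariance of the Drinfel'd polynomial under `⇓`. -/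
theorem drinfeldSum_reverse {R : Type*} [CommRing R] {d : ℕ} (β t₀ t₁ t₂ u₀ u₁ u₂ z : R)
    (j : ℕ) (hj : j ≤ d) :
    drinfeldSum d (recSeq β t₀ t₁ t₂) (recSeq β u₀ u₁ u₂) (recSeq β 0 1 (β + 2)) z
        (recSeq β t₀ t₁ t₂ j) =
      drinfeldSum d (fun k => recSeq β t₀ t₁ t₂ (d - k)) (recSeq β u₀ u₁ u₂)
        (recSeq β 0 1 (β + 2)) z (recSeq β t₀ t₁ t₂ j) := by
  exact reversalLeft_eq_reversalRight hj ![β, t₀, t₁, t₂, u₀, u₁, u₂, z]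

/-! ### The scalars α i, type by type. -/

section Alpha

variable {F : Type*} [Field F]

theorem chebyshevC_eval_add_three (β : F) (n : ℕ) :
    (Chebyshev.C F ((n + 3 : ℕ) : ℤ)).eval β = (Chebyshev.C F (n : ℤ)).eval β -
      (β + 1) * ((Chebyshev.C F ((n + 1 : ℕ) : ℤ)).eval β -
        (Chebyshev.C F ((n + 2 : ℕ) : ℤ)).eval β) := by
  have e1 : ((n + 3 : ℕ) : ℤ) = ((n + 1 : ℕ) : ℤ) + 2 := by push_cast; ring
  have e2 : ((n + 2 : ℕ) : ℤ) = (n : ℤ) + 2 := by push_cast; ring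
  have e3 : ((n + 1 : ℕ) : ℤ) + 1 = (n : ℤ) + 2 := by push_cast; ring
  have e4 : ((n + 1 : ℕ) : ℤ) = (n : ℤ) + 1 := by push_cast; ring
  rw [e1, Chebyshev.C_add_two, e3, e2, Chebyshev.C_add_two, e4]
  simp only [eval_sub, eval_mul, eval_X]
  ring

/-- The left side solves the same recurrence, with initial values 0, β - 2, β² - 4. -/
theorem chebyshevC_eval_eq_recSeq (β : F) (n : ℕ) :
    (Chebyshev.C F (n : ℤ)).eval β - 2 = (β - 2) * recSeq β 0 1 (β + 2) n := by
  induction n using recSeq.induct with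
  | case1 => simp [recSeq]
  | case2 => simp [recSeq]
  | case3 =>
    have : ((2 : ℕ) : ℤ) = 0 + 2 := rfl
    rw [this, Chebyshev.C_add_two]
    simp [recSeq]
    ring
  | case4 n h1 h2 h3 =>
    rw [Nat.succ_eq_add_one, chebyshevC_eval_add_three, recSeq]
    linear_combination h1 - (β + 1) * (h2 - h3)

theorem recSeq_two_eq_sq (n : ℕ) : recSeq (2 : F) 0 1 (2 + 2) n = (n : F) ^ 2 := by
  induction n using recSeq.induct with
  | case1 => simp [recSeq]
  | case2 => simp [recSeq]
  | case3 => norm_num [recSeq]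
  | case4 n h1 h2 h3 =>
    rw [recSeq, h1, h2, h3, Nat.succ_eq_add_one]
    push_cast
    ring

theorem recSeq_neg_two_eq_ite (n : ℕ) :
    recSeq (-2 : F) 0 1 (-2 + 2) n = if Even n then 0 else 1 := by
  induction n using recSeq.induct with
  | case1 => simp [recSeq]
  | case2 => simp [recSeq]
  | case3 => simp [recSeq]
  | case4 n h1 h2 h3 =>
    rw [recSeq, h1, h2, h3, Nat.succ_eq_add_one]
    by_cases h : Even n <;> simp [h, Nat.even_add_one, parity_simps] <;> norm_num

/-- The even terms of a sequence with `β = -2` are in arithmetic progression. -/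
theorem recSeq_neg_two_even (a b c : F) (m : ℕ) :
    recSeq (-2 : F) a b c (2 * m) = a + m * (c - a) := by
  have h : recSeq (-2 : F) a b c (2 * m) = a + m * (c - a) ∧
      recSeq (-2 : F) a b c (2 * m + 1) = b + m * (a - c) ∧
      recSeq (-2 : F) a b c (2 * m + 2) = a + (m + 1) * (c - a) := by
    induction m with
    | zero => simp [recSeq]
    | succ m ih =>
      have h3 : recSeq (-2 : F) a b c (2 * m + 3) = b + (m + 1) * (a - c) := by
        rw [recSeq, ih.1, ih.2.1, ih.2.2]
        ring
      refine ⟨?_, ?_, ?_⟩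
      · rw [show 2 * (m + 1) = 2 * m + 2 by ring, ih.2.2]; push_cast; ring
      · rw [show 2 * (m + 1) + 1 = 2 * m + 3 by ring, h3]; push_cast; ring
      · rw [show 2 * (m + 1) + 2 = (2 * m + 1) + 3 by ring, recSeq, ih.2.1, ih.2.2, h3]
        push_cast
        ring
  exact h.1

theorem recSeq_two_eq_quadratic (h2 : (2 : F) ≠ 0) (a b c : F) (n : ℕ) :
    recSeq (2 : F) a b c n = a + n * (b - a) + n * (n - 1) / 2 * (c - 2 * b + a) := by
  induction n using recSeq.induct with
  | case1 => simp [recSeq]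
  | case2 => simp [recSeq]
  | case3 => simp [recSeq]; field_simp; ring
  | case4 n h1 h3 h4 =>
    rw [recSeq, h1, h3, h4, Nat.succ_eq_add_one]
    push_cast
    field_simp
    ring

theorem tridiagonalType_cases {d : ℕ} {β : F} (h : tridiagonalType d β ≠ .IIIplus) :
    (tridiagonalType d β = .I ∧ β ≠ 2 ∧ β ≠ -2) ∨
    (tridiagonalType d β = .II ∧ β = 2 ∧ (2 : F) ≠ 0) ∨
    ((tridiagonalType d β = .IIIminus ∨ tridiagonalType d β = .IV) ∧ β = -2 ∧
      (Even d → (2 : F) = 0)) := by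
  unfold tridiagonalType at h ⊢
  by_cases h1 : β ≠ 2 ∧ β ≠ -2
  · simp [h1]
  rw [if_neg h1] at h ⊢
  by_cases h2 : CharP F 2
  · rw [if_pos h2]
    have h20 : (2 : F) = 0 := by exact_mod_cast CharP.cast_eq_zero F 2
    refine Or.inr (Or.inr ⟨Or.inr rfl, ?_, fun _ => h20⟩)
    rw [h20, neg_zero] at h1 ⊢
    by_contra h
    exact h1 ⟨h, h⟩
  · rw [if_neg h2] at h ⊢
    have h20 : (2 : F) ≠ 0 := fun h => h2 (CharTwo.of_one_ne_zero_of_two_eq_zero one_ne_zero h)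
    by_cases h3 : β = 2
    · simp [h3, h20]
    · have h4 : β = -2 := by
        by_contra h
        exact h1 ⟨h3, h⟩
      rw [if_neg h3] at h ⊢
      by_cases h5 : Even d
      · simp [h5] at h
      · rw [if_neg h5]
        exact Or.inr (Or.inr ⟨Or.inl rfl, h4, fun h => absurd h h5⟩)

theorem tridiagonalType_IIIplus {d : ℕ} {β : F} (h : tridiagonalType d β = .IIIplus) :
    β = -2 ∧ Even d ∧ (2 : F) ≠ 0 := by
  unfold tridiagonalType at h
  split_ifs at h with h1 h2 h3 h4
  refine ⟨?_, h4, fun h0 => h2 (CharTwo.of_one_ne_zero_of_two_eq_zero one_ne_zero h0)⟩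
  by_contra h5
  exact h1 ⟨h3, h5⟩

/-- The scalars `α i` are given by the solution of the recurrence starting with
`0, 1, β + 2`. -/
theorem drinfeldAlpha_eq_recSeq {d : ℕ} (hd : 1 ≤ d) {β t₀ t₁ t₂ : F}
    (hθ : ∀ i j, i ≤ d → j ≤ d → i ≠ j → recSeq β t₀ t₁ t₂ i ≠ recSeq β t₀ t₁ t₂ j)
    (hβ : d ≤ 2 → β ≠ 0) (htype : tridiagonalType d β ≠ .IIIplus) :
    recSeq β 0 1 (β + 2) d ≠ 0 ∧
      ∀ i, drinfeldAlpha d β i = recSeq β 0 1 (β + 2) i / recSeq β 0 1 (β + 2) d := by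
  rcases tridiagonalType_cases htype with ⟨ht, h1, h2⟩ | ⟨ht, rfl, h2⟩ | ⟨ht, rfl, h2⟩
  · constructor
    · intro h0
      obtain ⟨w, hw, hwβ⟩ := exists_add_inv_eq (algebraMap F (AlgebraicClosure F) β)
      have hinj := (algebraMap F (AlgebraicClosure F)).injective
      have hw1 : w ≠ 1 := by
        rintro rfl
        apply h1
        apply hinj
        rw [← hwβ, inv_one, map_ofNat]
        norm_num
      have hw2 : w ≠ -1 := by
        rintro rfl
        apply h2
        apply hinj
        rw [← hwβ, inv_neg, inv_one, map_neg, map_ofNat]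
        norm_num
      obtain ⟨a, b, c, hs⟩ := exists_recSeq_eq hw hw1 hw2 (algebraMap F (AlgebraicClosure F) t₀)
        (algebraMap F (AlgebraicClosure F) t₁) (algebraMap F (AlgebraicClosure F) t₂)
      have h3 := recSeq_square hw hw1 d
      have h4 := congrArg (algebraMap F (AlgebraicClosure F)) h0
      rw [map_recSeq, map_zero, map_one, map_add, map_ofNat, ← hwβ, h3] at h4
      have hw3 := sub_ne_zero.2 hw1
      -- Vanishing of the denominator makes w a d-th root of unity, and the closed form then gives θ
      -- d = θ 0.
      have h5 : w ^ d = 1 := by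
        have : (w ^ d - 1) ^ 2 = 0 := by
          rcases mul_eq_zero.1 h4 with h | h
          · exact absurd h (div_ne_zero hw (pow_ne_zero _ hw3))
          · exact (div_eq_zero_iff.1 h).resolve_right (pow_ne_zero _ hw)
        exact sub_eq_zero.1 (pow_eq_zero_iff two_ne_zero |>.1 this)
      refine hθ d 0 le_rfl (Nat.zero_le _) (by omega) (hinj ?_)
      rw [map_recSeq, map_recSeq, ← hwβ, hs, hs, h5, pow_zero]
    · intro i
      simp only [drinfeldAlpha, ht]
      rw [chebyshevC_eval_eq_recSeq, chebyshevC_eval_eq_recSeq,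
        mul_div_mul_left _ _ (sub_ne_zero.2 h1)]
  · simp only [recSeq_two_eq_sq]
    constructor
    · intro h0
      have h0' : (d : F) = 0 := pow_eq_zero_iff two_ne_zero |>.1 h0
      refine hθ d 0 le_rfl (Nat.zero_le _) (by omega) ?_
      rw [recSeq_two_eq_quadratic h2, recSeq_two_eq_quadratic h2, h0']
      simp
    · intro i
      simp only [drinfeldAlpha, ht]
  · simp only [recSeq_neg_two_eq_ite]
    have hodd : ¬ Even d := by
      intro hev
      have h20 := h2 hev
      -- Here β = -2 = 0, which a base forbids for d ≤ 2. An even d is therefore at least 4, and θ 4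
      -- = θ 0 + 2 (θ 2 - θ 0) = θ 0 is a contradiction.
      have hd4 : 4 ≤ d := by
        by_contra hlt
        refine hβ ?_ (by rw [h20, neg_zero])
        obtain ⟨m, rfl⟩ := hev
        omega
      refine hθ 4 0 hd4 (Nat.zero_le _) (by omega) ?_
      rw [show 4 = 2 * 2 from rfl, recSeq_neg_two_even, Nat.cast_ofNat, h20, zero_mul, add_zero,
        recSeq]
    rw [if_neg hodd]
    refine ⟨one_ne_zero, fun i => ?_⟩
    rw [div_one, drinfeldAlpha]
    rcases ht with ht | ht <;> simp only [ht]

/-- The even-indexed terms are in arithmetic progression, and θ 0 ≠ θ d keeps d from vanishing in F.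
-/
theorem recSeq_IIIplus {d : ℕ} (hd : Even d) (h2 : (2 : F) ≠ 0) {t₀ t₁ t₂ : F}
    (hθ : recSeq (-2 : F) t₀ t₁ t₂ 0 ≠ recSeq (-2 : F) t₀ t₁ t₂ d) :
    (d : F) ≠ 0 ∧ ∀ i, Even i → recSeq (-2 : F) t₀ t₁ t₂ 0 - recSeq (-2 : F) t₀ t₁ t₂ i =
      (i : F) / d * (recSeq (-2 : F) t₀ t₁ t₂ 0 - recSeq (-2 : F) t₀ t₁ t₂ d) := by
  obtain ⟨m, rfl⟩ := even_iff_exists_two_mul.1 hd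
  rw [recSeq_neg_two_even, recSeq] at hθ
  have hm : (m : F) ≠ 0 := by
    intro h
    rw [h, zero_mul, add_zero] at hθ
    exact hθ rfl
  refine ⟨by push_cast; exact mul_ne_zero h2 hm, fun i hi => ?_⟩
  obtain ⟨k, rfl⟩ := even_iff_exists_two_mul.1 hi
  rw [recSeq_neg_two_even, recSeq_neg_two_even, recSeq]
  push_cast
  field_simp
  ring

end Alpha

/-! ### Idempotent systems and the split decomposition. -/

/-- `E 0, …, E d` is a standard ordering of the primitive idempotents of the diagonalizable map
`A` relative to `B`, with eigenvalues `θ 0, …, θ d`; the indices are natural numbers, and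
`E k = 0` for `k > d`. -/
structure IsIdempotentSystem {F V : Type*} [Field F] [AddCommGroup V] [Module F V]
    (A B : Module.End F V) (d : ℕ) (E : ℕ → Module.End F V) (θ : ℕ → F) : Prop where
  sum_eq : ∑ k ∈ Finset.range (d + 1), E k = 1
  mul_self : ∀ k, E k * E k = E k
  mul_of_ne : ∀ i j, i ≠ j → E i * E j = 0
  left_mul : ∀ k, A * E k = θ k • E k
  mul_left : ∀ k, E k * A = θ k • E k
  ne_zero : ∀ k, k ≤ d → E k ≠ 0
  eq_zero : ∀ k, d < k → E k = 0
  inj : ∀ i j, i ≤ d → j ≤ d → θ i = θ j → i = j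
  tri : ∀ i j, i + 1 < j ∨ j + 1 < i → E i * B * E j = 0

/-- The vectors in `(E* 0 V + ⋯ + E* i V) ∩ (E (i+r) V + ⋯ + E d V)`. -/
def flagSpace {F V : Type*} [Field F] [AddCommGroup V] [Module F V]
    (E Es : ℕ → Module.End F V) (r i : ℕ) : Submodule F V where
  carrier := {v | (∀ k, i < k → Es k v = 0) ∧ ∀ k, k < i + r → E k v = 0}
  add_mem' := fun {a b} ha hb => ⟨fun k hk => by rw [map_add, ha.1 k hk, hb.1 k hk, add_zero],
    fun k hk => by rw [map_add, ha.2 k hk, hb.2 k hk, add_zero]⟩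
  zero_mem' := ⟨fun k _ => map_zero _, fun k _ => map_zero _⟩
  smul_mem' := fun c x hx => ⟨fun k hk => by rw [map_smul, hx.1 k hk, smul_zero],
    fun k hk => by rw [map_smul, hx.2 k hk, smul_zero]⟩

namespace IsIdempotentSystem

variable {F V : Type*} [Field F] [AddCommGroup V] [Module F V]
  {A B : Module.End F V} {d : ℕ} {E Es : ℕ → Module.End F V} {θ θs : ℕ → F}

theorem sum_apply (h : IsIdempotentSystem A B d E θ) (v : V) :
    ∑ k ∈ Finset.range (d + 1), E k v = v := by
  rw [← LinearMap.sum_apply, h.sum_eq, Module.End.one_apply]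

theorem mul_eq_sum (h : IsIdempotentSystem A B d E θ) (X Y : Module.End F V) :
    X * Y = ∑ k ∈ Finset.range (d + 1), X * E k * Y := by
  rw [← Finset.sum_mul, ← Finset.mul_sum, h.sum_eq, mul_one]

theorem apply_self_apply (h : IsIdempotentSystem A B d E θ) (k : ℕ) (v : V) :
    E k (E k v) = E k v := by
  rw [← Module.End.mul_apply, h.mul_self]

theorem apply_apply_of_ne (h : IsIdempotentSystem A B d E θ) {i j : ℕ} (hij : i ≠ j) (v : V) :
    E i (E j v) = 0 := by
  rw [← Module.End.mul_apply, h.mul_of_ne i j hij, LinearMap.zero_apply]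

theorem apply_map (h : IsIdempotentSystem A B d E θ) (k : ℕ) (v : V) :
    E k (A v) = θ k • E k v := by
  rw [← Module.End.mul_apply, h.mul_left, LinearMap.smul_apply]

theorem map_apply (h : IsIdempotentSystem A B d E θ) (k : ℕ) (v : V) :
    A (E k v) = θ k • E k v := by
  rw [← Module.End.mul_apply, h.left_mul, LinearMap.smul_apply]

theorem apply_sub_smul (h : IsIdempotentSystem A B d E θ) (k : ℕ) (c : F) (v : V) :
    E k (A v - c • v) = (θ k - c) • E k v := by
  rw [map_sub, h.apply_map, map_smul, sub_smul]

theorem apply_dual_eq_zero (h : IsIdempotentSystem A B d E θ) (k : ℕ) (v : V)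
    (hv : ∀ j, j ≤ k + 1 → k ≤ j + 1 → E j v = 0) : E k (B v) = 0 := by
  conv_lhs => rw [← h.sum_apply v]
  rw [map_sum, map_sum]
  refine Finset.sum_eq_zero fun j _ => ?_
  by_cases hj : j ≤ k + 1 ∧ k ≤ j + 1
  · rw [hv j hj.1 hj.2, map_zero, map_zero]
  · rw [← Module.End.mul_apply, ← Module.End.mul_apply, h.tri k j (by omega),
      LinearMap.zero_apply]

theorem apply_dual_sub_smul_eq_zero (h : IsIdempotentSystem A B d E θ) (k : ℕ) (c : F) (v : V)
    (hv : ∀ j, j ≤ k + 1 → k ≤ j + 1 → E j v = 0) : E k (B v - c • v) = 0 := by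
  rw [map_sub, h.apply_dual_eq_zero k v hv, map_smul, hv k (by omega) (by omega), smul_zero,
    sub_zero]

theorem left_sub_mem (h : IsIdempotentSystem A B d E θ) (hs : IsIdempotentSystem B A d Es θs)
    {r i : ℕ} {v : V} (hv : v ∈ flagSpace E Es r i) :
    A v - θ (i + r) • v ∈ flagSpace E Es r (i + 1) := by
  refine ⟨fun k hk => hs.apply_dual_sub_smul_eq_zero k _ v fun j _ hj => hv.1 j (by omega),
    fun k hk => ?_⟩
  rw [h.apply_sub_smul]
  by_cases hk' : k = i + r
  · rw [hk', sub_self, zero_smul]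
  · rw [hv.2 k (by omega), smul_zero]

theorem right_sub_mem (h : IsIdempotentSystem A B d E θ) (hs : IsIdempotentSystem B A d Es θs)
    {r i : ℕ} {v : V} (hv : v ∈ flagSpace E Es r (i + 1)) :
    B v - θs (i + 1) • v ∈ flagSpace E Es r i := by
  refine ⟨fun k hk => ?_,
    fun k hk => h.apply_dual_sub_smul_eq_zero k _ v fun j hj _ => hv.2 j (by omega)⟩
  rw [hs.apply_sub_smul]
  by_cases hk' : k = i + 1
  · rw [hk', sub_self, zero_smul]
  · rw [hv.1 k (by omega), smul_zero]

theorem right_sub_eq_zero (hs : IsIdempotentSystem B A d Es θs)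
    {r : ℕ} {v : V} (hv : v ∈ flagSpace E Es r 0) : B v = θs 0 • v := by
  have : Es 0 v = v := by
    conv_rhs => rw [← hs.sum_apply v]
    rw [Finset.sum_eq_single_of_mem 0 (by simp) fun k _ hk => hv.1 k (by omega)]
  rw [← this, hs.map_apply]

/-- A - θ (i + r) raises the level i, B - θs i lowers it, and B is a scalar on level 0; so the sum
is invariant. The case r = 0 is the split decomposition, while the spaces with r = 1 turn out to be
zero. -/
theorem iSup_flagSpace (h : IsIdempotentSystem A B d E θ) (hs : IsIdempotentSystem B A d Es θs)
    (irr : ∀ W : Submodule F V, W.map A ≤ W → W.map B ≤ W → W = ⊥ ∨ W = ⊤) (r : ℕ) :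
    ⨆ i, flagSpace E Es r i = ⊥ ∨ ⨆ i, flagSpace E Es r i = ⊤ := by
  have hle : ∀ i, flagSpace E Es r i ≤ ⨆ i, flagSpace E Es r i := le_iSup _
  apply irr
  · rw [Submodule.map_iSup]
    refine iSup_le fun i => ?_
    rintro _ ⟨v, hv, rfl⟩
    have := add_mem (hle _ (h.left_sub_mem hs hv)) (Submodule.smul_mem _ (θ (i + r)) (hle _ hv))
    rwa [sub_add_cancel] at this
  · rw [Submodule.map_iSup]
    refine iSup_le fun i => ?_
    rintro _ ⟨v, hv, rfl⟩
    cases i with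
    | zero =>
      rw [hs.right_sub_eq_zero hv]
      exact Submodule.smul_mem _ _ (hle _ hv)
    | succ i =>
      have := add_mem (hle _ (h.right_sub_mem hs hv))
        (Submodule.smul_mem _ (θs (i + 1)) (hle _ hv))
      rwa [sub_add_cancel] at this

/-- `E 0` kills every space with r = 1, so their sum is not V. -/
theorem flagSpace_one_eq_bot (h : IsIdempotentSystem A B d E θ)
    (hs : IsIdempotentSystem B A d Es θs)
    (irr : ∀ W : Submodule F V, W.map A ≤ W → W.map B ≤ W → W = ⊥ ∨ W = ⊤) {i : ℕ} {v : V}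
    (hv : v ∈ flagSpace E Es 1 i) : v = 0 := by
  rcases h.iSup_flagSpace hs irr 1 with h1 | h1
  · exact (Submodule.mem_bot F).1 (h1 ▸ le_iSup (flagSpace E Es 1) i hv)
  · exfalso
    refine h.ne_zero 0 (Nat.zero_le _) (LinearMap.ker_eq_top.1 (top_le_iff.1 ?_))
    rw [← h1]
    exact iSup_le fun i v hv => hv.2 0 (by omega)

theorem injOn_dual_range (h : IsIdempotentSystem A B d E θ)
    (hs : IsIdempotentSystem B A d Es θs)
    (irr : ∀ W : Submodule F V, W.map A ≤ W → W.map B ≤ W → W = ⊥ ∨ W = ⊤) {v : V}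
    (hv : Es 0 v = v) (h0 : E 0 v = 0) : v = 0 := by
  refine h.flagSpace_one_eq_bot hs irr (i := 0) ⟨fun k hk => ?_, fun k hk => ?_⟩
  · rw [← hv, hs.apply_apply_of_ne (by omega)]
  · rwa [show k = 0 by omega]

/-- `E 0` maps E*₀V bijectively onto E₀V. It is onto because V is the sum of the flag spaces with r
= 0, and `E 0` kills all of them above level 0. -/
theorem finrank_range_zero (h : IsIdempotentSystem A B d E θ)
    (hs : IsIdempotentSystem B A d Es θs)
    (irr : ∀ W : Submodule F V, W.map A ≤ W → W.map B ≤ W → W = ⊥ ∨ W = ⊤) :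
    Module.finrank F (LinearMap.range (E 0)) = Module.finrank F (LinearMap.range (Es 0)) := by
  have hinj : Function.Injective ((E 0).domRestrict (LinearMap.range (Es 0))) := by
    rw [← LinearMap.ker_eq_bot, LinearMap.ker_eq_bot']
    rintro ⟨_, ⟨v, rfl⟩⟩ hv
    exact Subtype.ext (h.injOn_dual_range hs irr (hs.apply_self_apply 0 v) hv)
  have hrange : LinearMap.range ((E 0).domRestrict (LinearMap.range (Es 0))) =
      LinearMap.range (E 0) := by
    rw [LinearMap.range_domRestrict]
    refine le_antisymm (LinearMap.map_le_range) ?_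
    have htop : ⨆ i, flagSpace E Es 0 i = ⊤ := by
      refine (h.iSup_flagSpace hs irr 0).resolve_left fun hbot => ?_
      refine hs.ne_zero 0 (Nat.zero_le _) (LinearMap.ext fun v => ?_)
      rw [LinearMap.zero_apply, ← Submodule.mem_bot F, ← hbot]
      exact le_iSup (flagSpace E Es 0) 0
        ⟨fun k hk => hs.apply_apply_of_ne (by omega) v, fun k hk => absurd hk (by omega)⟩
    rw [LinearMap.range_eq_map, ← htop, Submodule.map_iSup]
    refine iSup_le fun i => ?_
    rintro _ ⟨v, hv, rfl⟩
    cases i with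
    | zero =>
      have : Es 0 v = v := by
        conv_rhs => rw [← hs.sum_apply v]
        rw [Finset.sum_eq_single_of_mem 0 (by simp) fun k _ hk => hv.1 k (by omega)]
      exact ⟨v, ⟨v, this⟩, rfl⟩
    | succ i =>
      rw [hv.2 0 (by omega)]
      exact zero_mem _
  rw [← hrange]
  exact LinearMap.finrank_range_of_inj hinj

theorem aeval_mul (h : IsIdempotentSystem A B d E θ) (p : F[X]) (k : ℕ) :
    aeval A p * E k = p.eval (θ k) • E k := by
  induction p using Polynomial.induction_on' with
  | add p q hp hq => rw [map_add, add_mul, hp, hq, eval_add, add_smul]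
  | monomial n a =>
    have : A ^ n * E k = θ k ^ n • E k := by
      induction n with
      | zero => simp
      | succ n ih => rw [pow_succ, mul_assoc, h.left_mul, mul_smul_comm, ih, smul_smul, pow_succ,
          mul_comm]
    rw [aeval_monomial, eval_monomial, mul_assoc, this, ← Algebra.smul_def, smul_smul]

theorem mul_aeval (h : IsIdempotentSystem A B d E θ) (p : F[X]) (k : ℕ) :
    E k * aeval A p = p.eval (θ k) • E k := by
  have h1 : aeval A p * ∑ j ∈ Finset.range (d + 1), E j =
      ∑ j ∈ Finset.range (d + 1), p.eval (θ j) • E j := by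
    rw [Finset.mul_sum]
    exact Finset.sum_congr rfl fun j _ => h.aeval_mul p j
  rw [h.sum_eq, mul_one] at h1
  rw [h1, Finset.mul_sum]
  by_cases hk : k ≤ d
  · rw [Finset.sum_eq_single_of_mem k (Finset.mem_range.2 (by omega)) fun j _ hj => by
      rw [mul_smul_comm, h.mul_of_ne k j hj.symm, smul_zero], mul_smul_comm, h.mul_self]
  · rw [h.eq_zero k (by omega)]
    simp

theorem aeval_eq_sum (h : IsIdempotentSystem A B d E θ) (p : F[X]) :
    aeval A p = ∑ j ∈ Finset.range (d + 1), p.eval (θ j) • E j := by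
  rw [← mul_one (aeval A p), ← h.sum_eq, Finset.mul_sum]
  exact Finset.sum_congr rfl fun j _ => h.aeval_mul p j

theorem mul_dual_pow_mul (h : IsIdempotentSystem A B d E θ) (n i j : ℕ)
    (hij : i + n < j ∨ j + n < i) : E i * B ^ n * E j = 0 := by
  induction n generalizing i with
  | zero => rw [pow_zero, mul_one, h.mul_of_ne i j (by omega)]
  | succ n ih =>
    rw [pow_succ', ← mul_assoc, mul_assoc, h.mul_eq_sum (E i * B)]
    refine Finset.sum_eq_zero fun k _ => ?_
    by_cases hk : i + 1 < k ∨ k + 1 < i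
    · rw [h.tri i k hk, zero_mul]
    · rw [mul_assoc, ← mul_assoc (E k), ih k (by omega), mul_zero]

/-- Each B moves the index by at most one, so n + m steps from i to i + m + n must be at i + m after
m of them. -/
theorem mul_dual_pow_add_mul (h : IsIdempotentSystem A B d E θ) {i m n : ℕ} (hd : i + m + n ≤ d) :
    E (i + m + n) * B ^ (n + m) * E i =
      (E (i + m + n) * B ^ n * E (i + m)) * (E (i + m) * B ^ m * E i) := by
  have h1 : E (i + m + n) * B ^ (n + m) * E i = (E (i + m + n) * B ^ n) * (B ^ m * E i) := by
    rw [pow_add]; simp only [mul_assoc]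
  rw [h1, h.mul_eq_sum, Finset.sum_eq_single_of_mem (i + m) (Finset.mem_range.2 (by omega))]
  · simp only [mul_assoc]
    rw [← mul_assoc (E (i + m)) (E (i + m)), h.mul_self]
  · intro k _ hk
    rcases Nat.lt_or_gt_of_ne hk with hlt | hgt
    · rw [h.mul_dual_pow_mul n _ k (by omega), zero_mul]
    · rw [mul_assoc, ← mul_assoc (E k), h.mul_dual_pow_mul m k i (by omega), mul_zero]

theorem mul_dual_aeval_mul (h : IsIdempotentSystem A B d E θ) (p : F[X]) (i j : ℕ)
    (hij : i + p.natDegree < j ∨ j + p.natDegree < i) : E i * aeval B p * E j = 0 := by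
  rw [aeval_eq_sum_range, Finset.mul_sum, Finset.sum_mul]
  refine Finset.sum_eq_zero fun n hn => ?_
  rw [Finset.mem_range] at hn
  rw [mul_smul_comm, smul_mul_assoc, h.mul_dual_pow_mul n i j (by omega), smul_zero]

theorem mul_dual_aeval_mul_top (h : IsIdempotentSystem A B d E θ) (p : F[X]) (i n : ℕ)
    (hp : p.natDegree ≤ n) : E (i + n) * aeval B p * E i = p.coeff n • (E (i + n) * B ^ n * E i) := by
  rw [aeval_eq_sum_range' (Nat.lt_succ_of_le hp), Finset.mul_sum, Finset.sum_mul,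
    Finset.sum_eq_single_of_mem n (Finset.mem_range.2 (Nat.lt_succ_self n))]
  · rw [mul_smul_comm, smul_mul_assoc]
  · intro k hk hkn
    rw [Finset.mem_range] at hk
    rw [mul_smul_comm, smul_mul_assoc, h.mul_dual_pow_mul k _ i (by omega), smul_zero]

end IsIdempotentSystem

/-! ### Nonvanishing of extreme blocks and existence of a base. -/

theorem natDegree_prod_range_X_sub_C {F : Type*} [Field F] (θ : ℕ → F) (k : ℕ) :
    (∏ j ∈ Finset.range k, (X - C (θ j))).natDegree = k := by
  rw [natDegree_prod_of_monic _ _ fun j _ => monic_X_sub_C _]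
  simp

namespace IsIdempotentSystem

variable {F V : Type*} [Field F] [AddCommGroup V] [Module F V]
  {A B : Module.End F V} {d : ℕ} {E Es : ℕ → Module.End F V} {θ θs : ℕ → F}

theorem aeval_prod_mem (h : IsIdempotentSystem A B d E θ) (hs : IsIdempotentSystem B A d Es θs)
    {u : V} (hu : Es 0 u = u) (k : ℕ) :
    aeval A (∏ j ∈ Finset.range k, (X - C (θ j))) u ∈ flagSpace E Es 0 k := by
  induction k with
  | zero =>
    simp only [Finset.prod_range_zero, map_one, Module.End.one_apply]
    exact ⟨fun k hk => by rw [← hu, hs.apply_apply_of_ne (by omega)], fun k hk => absurd hk (by omega)⟩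
  | succ k ih =>
    have := h.left_sub_mem hs ih
    rw [Finset.prod_range_succ, mul_comm, map_mul, Module.End.mul_apply]
    simpa using this

/-- For i = 0: if the block vanished, τₙ(A)u with u in E*₀V would lie in a flag space with r = 1 and
so be zero. Applying `E d` gives τₙ(θ d) E d u = 0, whence u = 0 by `hd`. The general block is a
factor of the one from 0 to i + n. -/
theorem dual_mul_pow_mul_ne_zero (h : IsIdempotentSystem A B d E θ)
    (hs : IsIdempotentSystem B A d Es θs)
    (irr : ∀ W : Submodule F V, W.map A ≤ W → W.map B ≤ W → W = ⊥ ∨ W = ⊤)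
    (hd : ∀ v, Es 0 v = v → E d v = 0 → v = 0) {i n : ℕ} (hin : i + n ≤ d) :
    Es (i + n) * A ^ n * Es i ≠ 0 := by
  have h0 : ∀ k, k ≤ d → Es (0 + k) * A ^ k * Es 0 ≠ 0 := by
    intro k hk hzero
    have hτ := hs.mul_dual_aeval_mul_top (∏ j ∈ Finset.range k, (X - C (θ j))) 0 k
      (natDegree_prod_range_X_sub_C θ k).le
    rw [hzero, smul_zero, zero_add] at hτ
    refine hs.ne_zero 0 (Nat.zero_le _) (LinearMap.ext fun v => ?_)
    rw [LinearMap.zero_apply]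
    have hu := hs.apply_self_apply 0 v
    have hτv : Es k (aeval A (∏ j ∈ Finset.range k, (X - C (θ j))) (Es 0 v)) = 0 := by
      have := congrArg (fun f => f v) hτ
      simpa [Module.End.mul_apply] using this
    rcases Nat.eq_zero_or_pos k with rfl | hk0
    · simpa [hu] using hτv
    · have hmem := h.aeval_prod_mem hs hu k
      have hz : aeval A (∏ j ∈ Finset.range k, (X - C (θ j))) (Es 0 v) = 0 := by
        refine h.flagSpace_one_eq_bot hs irr (i := k - 1) ⟨fun m hm => ?_, fun m hm => ?_⟩
        · by_cases hmk : m = k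
          · rw [hmk, hτv]
          · exact hmem.1 m (by omega)
        · exact hmem.2 m (by omega)
      have hE := congrArg (fun f => f (Es 0 v))
        (h.mul_aeval (∏ j ∈ Finset.range k, (X - C (θ j))) d)
      simp only [Module.End.mul_apply, hz, map_zero, LinearMap.smul_apply] at hE
      refine hd _ hu ((smul_eq_zero.1 hE.symm).resolve_left ?_)
      rw [eval_prod]
      refine Finset.prod_ne_zero_iff.2 fun j hj => ?_
      rw [Finset.mem_range] at hj
      rw [eval_sub, eval_X, eval_C, sub_ne_zero]
      intro he
      have := h.inj d j le_rfl (by omega) he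
      omega
  have hk := h0 (i + n) hin
  have := hs.mul_dual_pow_add_mul (i := 0) (m := i) (n := n) (by omega)
  rw [zero_add] at this
  rw [zero_add, add_comm i n] at hk
  rw [add_comm n i] at hk this
  intro hz
  rw [add_comm i n] at hk hz this
  rw [this, hz, zero_mul] at hk
  exact hk rfl

theorem ext_of_mul_mul (h : IsIdempotentSystem A B d E θ) {X Y : Module.End F V}
    (hXY : ∀ i j, E i * X * E j = E i * Y * E j) : X = Y := by
  have : ∀ Z : Module.End F V, Z = ∑ i ∈ Finset.range (d + 1), ∑ j ∈ Finset.range (d + 1),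
      E i * Z * E j := by
    intro Z
    simp only [← Finset.mul_sum, ← Finset.sum_mul, h.sum_eq, one_mul, mul_one]
  rw [this X, this Y]
  simp only [hXY]

theorem mul_pow_dual_pow_mul_eq_zero (hs : IsIdempotentSystem B A d Es θs) {m n i j : ℕ}
    (hij : i + n + m < j) : Es j * (A ^ m * B * A ^ n) * Es i = 0 := by
  have : Es j * (A ^ m * B * A ^ n) * Es i = (Es j * A ^ m) * (B * A ^ n * Es i) := by
    simp only [mul_assoc]
  rw [this, hs.mul_eq_sum]
  refine Finset.sum_eq_zero fun k _ => ?_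
  by_cases hk : k + m < j
  · rw [hs.mul_dual_pow_mul m j k (by omega), zero_mul]
  · rw [mul_assoc, ← mul_assoc (Es k), ← mul_assoc (Es k), hs.mul_left, smul_mul_assoc,
      smul_mul_assoc, hs.mul_dual_pow_mul n k i (by omega), smul_zero, mul_zero]

theorem mul_pow_dual_pow_mul_eq (hs : IsIdempotentSystem B A d Es θs) {m n i : ℕ}
    (hd : i + n + m ≤ d) : Es (i + n + m) * (A ^ m * B * A ^ n) * Es i =
      θs (i + n) • (Es (i + n + m) * A ^ (m + n) * Es i) := by
  have : Es (i + n + m) * (A ^ m * B * A ^ n) * Es i =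
      (Es (i + n + m) * A ^ m) * (B * A ^ n * Es i) := by
    simp only [mul_assoc]
  rw [this, hs.mul_eq_sum, Finset.sum_eq_single_of_mem (i + n) (Finset.mem_range.2 (by omega)),
    hs.mul_dual_pow_add_mul hd]
  · rw [mul_assoc, ← mul_assoc (Es (i + n)), ← mul_assoc (Es (i + n)), hs.mul_left,
      smul_mul_assoc, smul_mul_assoc, mul_smul_comm]
    simp only [mul_assoc]
    rw [← mul_assoc (Es (i + n)) (Es (i + n)), hs.mul_self]
  · intro k _ hk
    rcases Nat.lt_or_gt_of_ne hk with hlt | hgt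
    · rw [hs.mul_dual_pow_mul m _ k (by omega), zero_mul]
    · rw [mul_assoc, ← mul_assoc (Es k), ← mul_assoc (Es k), hs.mul_left, smul_mul_assoc,
        smul_mul_assoc, hs.mul_dual_pow_mul n k i (by omega), smul_zero, mul_zero]

/-- There is a polynomial `f` with `A² B A - A B A² = f(A) B - B f(A)`. -/
theorem exists_polynomial_commutator (h : IsIdempotentSystem A B d E θ) :
    ∃ f : F[X], f.natDegree ≤ d ∧
      A ^ 2 * B * A ^ 1 - A ^ 1 * B * A ^ 2 = aeval A f * B - B * aeval A f ∧
      ∀ i, i + 1 ≤ d → f.eval (θ i) - f.eval (θ (i + 1)) = θ i * θ (i + 1) * (θ i - θ (i + 1)) := by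
  -- The values that f should take at the θ n, chosen to have the prescribed consecutive
  -- differences.
  let x : ℕ → F := fun n => -∑ i ∈ Finset.range n, θ i * θ (i + 1) * (θ i - θ (i + 1))
  have hx : ∀ i, x i - x (i + 1) = θ i * θ (i + 1) * (θ i - θ (i + 1)) := by
    intro i
    simp only [x, Finset.sum_range_succ]
    ring
  have hinj : Set.InjOn θ (Finset.range (d + 1)) := by
    intro i hi j hj hij
    simp only [Finset.coe_range, Set.mem_Iio] at hi hj
    exact h.inj i j (by omega) (by omega) hij
  let f := Lagrange.interpolate (Finset.range (d + 1)) θ x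
  have hf : ∀ i, i ≤ d → f.eval (θ i) = x i := fun i hi =>
    Lagrange.eval_interpolate_at_node x hinj (Finset.mem_range.2 (by omega))
  have hstep : ∀ i, i + 1 ≤ d →
      f.eval (θ i) - f.eval (θ (i + 1)) = θ i * θ (i + 1) * (θ i - θ (i + 1)) := by
    intro i hi
    rw [hf _ (by omega), hf _ hi, hx]
  refine ⟨f, ?_, ?_, hstep⟩
  · have := Lagrange.degree_interpolate_lt x hinj
    rw [Finset.card_range] at this
    exact natDegree_le_iff_coeff_eq_zero.2 fun N hN =>
      (degree_lt_iff_coeff_zero _ _).1 this N (by omega)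
  -- Both sides compress to multiples of E i B E j, which is zero unless i and j differ by at most
  -- one; so the consecutive differences of f suffice.
  · refine h.ext_of_mul_mul fun i j => ?_
    have e1 : E i * (A ^ 2 * B * A ^ 1) * E j = (θ i * θ i * θ j) • (E i * B * E j) := by
      have : E i * (A ^ 2 * B * A ^ 1) * E j = E i * A * A * B * (A * E j) := by
        simp only [pow_two, pow_one, mul_assoc]
      rw [this, h.mul_left, smul_mul_assoc, h.mul_left, h.left_mul]
      simp only [smul_mul_assoc, mul_smul_comm, smul_smul]
      congr 1; ring
    have e2 : E i * (A ^ 1 * B * A ^ 2) * E j = (θ i * θ j * θ j) • (E i * B * E j) := by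
      have : E i * (A ^ 1 * B * A ^ 2) * E j = E i * A * B * (A * (A * E j)) := by
        simp only [pow_two, pow_one, mul_assoc]
      rw [this, h.mul_left, h.left_mul, mul_smul_comm, h.left_mul]
      simp only [smul_mul_assoc, mul_smul_comm, smul_smul]
      congr 1; ring
    have e3 : E i * (aeval A f * B) * E j = f.eval (θ i) • (E i * B * E j) := by
      rw [← mul_assoc, h.mul_aeval]
      simp only [smul_mul_assoc]
    have e4 : E i * (B * aeval A f) * E j = f.eval (θ j) • (E i * B * E j) := by
      rw [mul_assoc, mul_assoc, h.aeval_mul]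
      simp only [mul_smul_comm, mul_assoc]
    rw [mul_sub, sub_mul, mul_sub, sub_mul, e1, e2, e3, e4, ← sub_smul, ← sub_smul]
    by_cases hij : i + 1 < j ∨ j + 1 < i
    · rw [h.tri i j hij, smul_zero, smul_zero]
    by_cases hid : d < i
    · rw [h.eq_zero i hid, zero_mul, zero_mul, smul_zero, smul_zero]
    by_cases hjd : d < j
    · rw [h.eq_zero j hjd, mul_zero, smul_zero, smul_zero]
    congr 1
    obtain rfl | rfl | rfl : i = j ∨ j = i + 1 ∨ i = j + 1 := by omega
    · ring
    · rw [hstep i (by omega)]; ring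
    · have := hstep j (by omega)
      linear_combination this

/-- Compressing the commutator relation between Es i and Es (i + n) compares coefficients of the
nonzero block Es (i + n) Aⁿ Es i. For n = deg f > 3 this is impossible, and n = 3 yields the
recurrence for `θs`, with 1/(β + 1) the cubic coefficient of f. -/
theorem exists_base (h : IsIdempotentSystem A B d E θ) (hs : IsIdempotentSystem B A d Es θs)
    (hne : ∀ i n, i + n ≤ d → Es (i + n) * A ^ n * Es i ≠ 0) (hd : 3 ≤ d) :
    ∃ β : F, ∀ k, k + 3 ≤ d → θ k - θ (k + 3) = (β + 1) * (θ (k + 1) - θ (k + 2)) ∧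
      θs k - θs (k + 3) = (β + 1) * (θs (k + 1) - θs (k + 2)) := by
  obtain ⟨f, hfd, hf, hstep⟩ := h.exists_polynomial_commutator
  have hcomm : ∀ i n, f.natDegree ≤ n → Es (i + n) * (aeval A f * B - B * aeval A f) * Es i =
      ((θs i - θs (i + n)) * f.coeff n) • (Es (i + n) * A ^ n * Es i) := by
    intro i n hn
    have e1 : Es (i + n) * (aeval A f * B) * Es i = θs i • (Es (i + n) * aeval A f * Es i) := by
      rw [mul_assoc, mul_assoc, hs.left_mul]
      simp only [mul_smul_comm, mul_assoc]
    have e2 : Es (i + n) * (B * aeval A f) * Es i =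
        θs (i + n) • (Es (i + n) * aeval A f * Es i) := by
      rw [← mul_assoc, hs.mul_left]
      simp only [smul_mul_assoc]
    rw [mul_sub, sub_mul, e1, e2, ← sub_smul, hs.mul_dual_aeval_mul_top f i n hn, smul_smul]
  have h3 : f.natDegree ≤ 3 := by
    by_contra hlt
    push Not at hlt
    have h1 := hcomm 0 f.natDegree le_rfl
    rw [← hf, mul_sub, sub_mul, hs.mul_pow_dual_pow_mul_eq_zero (by omega),
      hs.mul_pow_dual_pow_mul_eq_zero (by omega), sub_zero] at h1
    rcases smul_eq_zero.1 h1.symm with h2 | h2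
    · rcases mul_eq_zero.1 h2 with h2 | h2
      · have := hs.inj _ _ (by omega) (by omega) (sub_eq_zero.1 h2)
        omega
      · rw [coeff_natDegree, leadingCoeff_eq_zero] at h2
        rw [h2, natDegree_zero] at hlt
        omega
    · exact hne _ _ (by omega) h2
  have hdual : ∀ k, k + 3 ≤ d → θs (k + 1) - θs (k + 2) = (θs k - θs (k + 3)) * f.coeff 3 := by
    intro k hk
    have h1 := hcomm k 3 h3
    have e1 := hs.mul_pow_dual_pow_mul_eq (m := 2) (n := 1) (i := k) (by omega)
    have e2 := hs.mul_pow_dual_pow_mul_eq (m := 1) (n := 2) (i := k) (by omega)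
    rw [← hf, mul_sub, sub_mul, show k + 3 = k + 1 + 2 by ring, e1, show k + 1 + 2 = k + 2 + 1 by ring,
      e2, show 2 + 1 = 3 by rfl, ← sub_smul] at h1
    exact smul_left_injective F (hne k 3 hk) h1
  have hc : f.coeff 3 ≠ 0 := by
    intro hc
    have h1 := hdual 0 (by omega)
    rw [hc, mul_zero] at h1
    have := hs.inj _ _ (by omega) (by omega) (sub_eq_zero.1 h1)
    omega
  refine ⟨(f.coeff 3)⁻¹ - 1, fun k hk => ⟨?_, ?_⟩⟩
  · have hev : ∀ t, f.eval t = f.coeff 0 + f.coeff 1 * t + f.coeff 2 * t ^ 2 + f.coeff 3 * t ^ 3 := by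
      intro t
      rw [eval_eq_sum_range' (n := 4) (by omega)]
      simp [Finset.sum_range_succ]
    have hn : ∀ i j, i ≤ d → j ≤ d → i ≠ j → θ i - θ j ≠ 0 := fun i j hi hj hij he =>
      hij (h.inj i j hi hj (sub_eq_zero.1 he))
    -- `hG` and `hH` compute the first and second divided differences of the cubic f; subtracting
    -- consecutive instances of `hH` gives the recurrence for `θ`.
    have hG : ∀ i, i + 1 ≤ d → f.coeff 1 + f.coeff 2 * (θ i + θ (i + 1)) +
        f.coeff 3 * (θ i ^ 2 + θ i * θ (i + 1) + θ (i + 1) ^ 2) = θ i * θ (i + 1) := by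
      intro i hi
      have h1 := hstep i hi
      rw [hev, hev] at h1
      refine mul_left_cancel₀ (hn i (i + 1) (by omega) hi (by omega)) ?_
      linear_combination h1
    have hH : ∀ i, i + 2 ≤ d → f.coeff 2 + f.coeff 3 * (θ i + θ (i + 1) + θ (i + 2)) =
        θ (i + 1) := by
      intro i hi
      have h1 := hG i (by omega)
      have h2 := hG (i + 1) (by omega)
      rw [show i + 1 + 1 = i + 2 by ring] at h2
      refine mul_left_cancel₀ (hn i (i + 2) (by omega) hi (by omega)) ?_
      linear_combination h1 - h2
    have h1 := hH k (by omega)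
    have h2 := hH (k + 1) (by omega)
    rw [show k + 1 + 1 = k + 2 by ring, show k + 1 + 2 = k + 3 by ring] at h2
    rw [sub_add_cancel, ← div_eq_inv_mul, eq_div_iff hc]
    linear_combination h1 - h2
  · rw [sub_add_cancel, hdual k hk]
    field_simp

end IsIdempotentSystem

/-! ### The split sequence and its self-duality. -/

theorem degree_prod_range_sub_lt {F : Type*} [Field F] (a b : ℕ → F) (i : ℕ) :
    ((∏ j ∈ Finset.range i, (X - C (a j))) - ∏ j ∈ Finset.range i, (X - C (b j))).degree < (i : WithBot ℕ) := by
  have hm : ∀ a : ℕ → F, (∏ j ∈ Finset.range i, (X - C (a j))).Monic := fun a =>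
    monic_prod_of_monic _ _ fun j _ => monic_X_sub_C _
  have hdeg : ∀ a : ℕ → F, (∏ j ∈ Finset.range i, (X - C (a j))).degree = (i : WithBot ℕ) := fun a => by
    rw [degree_eq_natDegree (hm a).ne_zero, natDegree_prod_range_X_sub_C]
  rw [← hdeg a]
  exact degree_sub_lt_left (by rw [hdeg, hdeg]) (hm a).ne_zero (by rw [hm a, hm b])

/-- An endomorphism of a line is a scalar; sharpness enters through this. -/
theorem exists_mul_mul_eq_smul {F V : Type*} [Field F] [AddCommGroup V] [Module F V]
    {P : Module.End F V} (hP : Module.finrank F (LinearMap.range P) = 1) (Z : Module.End F V) :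
    ∃ c : F, P * Z * P = c • P := by
  obtain ⟨⟨v, hv⟩, _, hspan⟩ := finrank_eq_one_iff'.1 hP
  obtain ⟨c, hc⟩ := hspan ⟨P (Z v), LinearMap.mem_range_self _ _⟩
  have hc' : P (Z v) = c • v := (congrArg Subtype.val hc).symm
  refine ⟨c, LinearMap.ext fun u => ?_⟩
  obtain ⟨a, ha⟩ := hspan ⟨P u, LinearMap.mem_range_self _ _⟩
  have ha' : P u = a • v := (congrArg Subtype.val ha).symm
  rw [Module.End.mul_apply, Module.End.mul_apply, LinearMap.smul_apply, ha', map_smul, map_smul, hc',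
    smul_comm]

namespace IsIdempotentSystem

variable {F V : Type*} [Field F] [AddCommGroup V] [Module F V]
  {A B : Module.End F V} {d : ℕ} {E Es : ℕ → Module.End F V} {θ θs : ℕ → F}

theorem mul_dual_aeval_mul_of_degree_lt (h : IsIdempotentSystem A B d E θ) {p : F[X]} {n i j : ℕ}
    (hp : p.degree < n) (hij : i + n ≤ j ∨ j + n ≤ i) : E i * aeval B p * E j = 0 := by
  by_cases hp0 : p = 0
  · rw [hp0, map_zero, mul_zero, zero_mul]
  · have := (natDegree_lt_iff_degree_lt hp0).2 hp
    exact h.mul_dual_aeval_mul p i j (by omega)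

/-- Of the components Es k, those with 1 ≤ k ≤ i are killed by the polynomial in B, and those with k
> i are out of reach of a polynomial of degree i in A. -/
theorem dual_splitMap_mul (hs : IsIdempotentSystem B A d Es θs) (i : ℕ) (θ : ℕ → F) :
    aeval B (∏ j ∈ Finset.range i, (X - C (θs (j + 1)))) *
        aeval A (∏ j ∈ Finset.range i, (X - C (θ j))) * Es 0 =
      (∏ j ∈ Finset.range i, (θs 0 - θs (j + 1))) •
        (Es 0 * aeval A (∏ j ∈ Finset.range i, (X - C (θ j))) * Es 0) := by
  rw [← one_mul (aeval B _), mul_assoc, mul_assoc, ← hs.sum_eq, Finset.sum_mul,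
    Finset.sum_eq_single_of_mem 0 (by simp)]
  · rw [← mul_assoc, hs.mul_aeval, eval_prod, smul_mul_assoc]
    simp only [eval_sub, eval_X, eval_C, mul_assoc]
  · intro k _ hk
    rw [← mul_assoc, hs.mul_aeval, smul_mul_assoc, ← mul_assoc]
    by_cases hki : k ≤ i
    · rw [eval_prod, Finset.prod_eq_zero (i := k - 1) (Finset.mem_range.2 (by omega)), zero_smul]
      rw [Nat.sub_add_cancel (by omega)]
      simp
    · rw [hs.mul_dual_aeval_mul _ k 0 (by rw [natDegree_prod_range_X_sub_C]; omega), smul_zero]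

/-- The product kills Es k for k < i, and a polynomial of degree below i in A does not reach Es k
from Es 0 for k ≥ i. So, next to this product, monic polynomials of degree i in A are
interchangeable. -/
theorem dual_mul_prod_mul_aeval_mul (hs : IsIdempotentSystem B A d Es θs) {q : F[X]} {i : ℕ} (hq : q.degree < i)
    (Y : Module.End F V) :
    Y * aeval B (∏ j ∈ Finset.range i, (X - C (θs j))) * aeval A q * Es 0 = 0 := by
  rw [mul_assoc, mul_assoc, ← mul_assoc, hs.mul_eq_sum]
  refine Finset.sum_eq_zero fun k _ => ?_
  by_cases hk : k < i
  · rw [mul_assoc Y, hs.aeval_mul, eval_prod, Finset.prod_eq_zero (Finset.mem_range.2 hk) (by simp),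
      zero_smul, mul_zero, zero_mul]
  · rw [mul_assoc _ (Es k), ← mul_assoc (Es k), hs.mul_dual_aeval_mul_of_degree_lt hq (by omega),
      mul_zero]

theorem mul_aeval_mul_prod_mul (h : IsIdempotentSystem A B d E θ) {q : F[X]} {i : ℕ}
    (hq : q.degree < i) (Y : Module.End F V) :
    E 0 * aeval B q * aeval A (∏ j ∈ Finset.range i, (X - C (θ j))) * Y = 0 := by
  rw [mul_assoc, h.mul_eq_sum]
  refine Finset.sum_eq_zero fun k _ => ?_
  by_cases hk : k < i
  · rw [mul_assoc _ (E k), ← mul_assoc (E k), h.mul_aeval, eval_prod,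
      Finset.prod_eq_zero (Finset.mem_range.2 hk) (by simp), zero_smul, zero_mul, mul_zero]
  · rw [h.mul_dual_aeval_mul_of_degree_lt hq (by omega), zero_mul]

/-- The split sequences of a sharp tridiagonal system and of its dual coincide. -/
theorem splitMap_eigenvalue_dual (h : IsIdempotentSystem A B d E θ)
    (hs : IsIdempotentSystem B A d Es θs) (hne : E 0 * Es 0 ≠ 0) {i : ℕ} {z z' : F}
    (hz : aeval B (∏ j ∈ Finset.range i, (X - C (θs (j + 1)))) *
      aeval A (∏ j ∈ Finset.range i, (X - C (θ j))) * Es 0 = z • Es 0)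
    (hz' : aeval A (∏ j ∈ Finset.range i, (X - C (θ (j + 1)))) *
      aeval B (∏ j ∈ Finset.range i, (X - C (θs j))) * E 0 = z' • E 0) : z = z' := by
  set σA := ∏ j ∈ Finset.range i, (X - C (θ (j + 1))) with hσA
  set σB := ∏ j ∈ Finset.range i, (X - C (θs (j + 1))) with hσB
  set τA := ∏ j ∈ Finset.range i, (X - C (θ j)) with hτA
  set τB := ∏ j ∈ Finset.range i, (X - C (θs j)) with hτB
  have h1 : E 0 * aeval B τB * aeval A σA * Es 0 = z' • (E 0 * Es 0) := by
    have e1 : z' • E 0 = E 0 * aeval B τB * (σA.eval (θ 0) • E 0) := by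
      rw [hσA, hτB] at *
      rw [← hz', h.dual_splitMap_mul i θs, mul_smul_comm, eval_prod]
      simp only [eval_sub, eval_X, eval_C]
    rw [← smul_mul_assoc, e1]
    congr 1
    rw [h.aeval_eq_sum σA, Finset.mul_sum, Finset.sum_eq_single_of_mem 0 (by simp)]
    intro k _ hk
    by_cases hki : k ≤ i
    · rw [hσA, eval_prod, Finset.prod_eq_zero (i := k - 1) (Finset.mem_range.2 (by omega)),
        zero_smul, mul_zero]
      rw [Nat.sub_add_cancel (by omega)]
      simp
    · rw [mul_smul_comm, h.mul_dual_aeval_mul _ 0 k (by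
        rw [hτB, natDegree_prod_range_X_sub_C]; omega), smul_zero]
  have h2 : E 0 * aeval B σB * aeval A τA * Es 0 = z • (E 0 * Es 0) := by
    rw [mul_assoc, mul_assoc, ← mul_assoc (aeval B σB), hz, mul_smul_comm]
  -- σ and τ are monic of the same degree, so both expressions equal E 0 τB(B) τA(A) Es 0.
  have h3 := hs.dual_mul_prod_mul_aeval_mul (degree_prod_range_sub_lt (fun j => θ (j + 1)) θ i) (E 0)
  have h4 := h.mul_aeval_mul_prod_mul (degree_prod_range_sub_lt (fun j => θs (j + 1)) θs i) (Es 0)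
  rw [map_sub, mul_sub, sub_mul, sub_eq_zero] at h3
  rw [map_sub, mul_sub, sub_mul, sub_mul, sub_eq_zero] at h4
  have h5 : z • (E 0 * Es 0) = z' • (E 0 * Es 0) := by
    rw [← h1, ← h2]
    exact h4.trans h3.symm
  exact smul_left_injective F hne h5

end IsIdempotentSystem

/-! ### Passage from families over `Fin (d + 1)` to sequences. -/

/-- Extension of a finite sequence by zero. -/
def extendZero {M : Type*} [Zero M] {d : ℕ} (f : Fin (d + 1) → M) (k : ℕ) : M :=
  if h : k < d + 1 then f ⟨k, h⟩ else 0

theorem extendZero_of_le {M : Type*} [Zero M] {d : ℕ} (f : Fin (d + 1) → M) {k : ℕ} (h : k ≤ d) :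
    extendZero f k = f ⟨k, Nat.lt_succ_of_le h⟩ := dif_pos _

theorem extendZero_val {M : Type*} [Zero M] {d : ℕ} (f : Fin (d + 1) → M) (i : Fin (d + 1)) :
    extendZero f i = f i := dif_pos i.isLt

theorem extendZero_of_lt {M : Type*} [Zero M] {d : ℕ} (f : Fin (d + 1) → M) {k : ℕ} (h : d < k) :
    extendZero f k = 0 := dif_neg (by omega)

theorem extendZero_zero {M : Type*} [Zero M] {d : ℕ} (f : Fin (d + 1) → M) :
    extendZero f 0 = f 0 := extendZero_val f 0

theorem extendZero_rev {M : Type*} [Zero M] {d : ℕ} (f : Fin (d + 1) → M) {k : ℕ} (h : k ≤ d) :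
    extendZero (fun i => f (Fin.rev i)) k = extendZero f (d - k) := by
  rw [extendZero_of_le _ h, extendZero_of_le _ (Nat.sub_le d k)]
  congr 1
  ext
  simp [Fin.val_rev]

theorem prod_Iio_fin {M : Type*} [CommMonoid M] {d : ℕ} (g : ℕ → M) (i : Fin (d + 1)) :
    ∏ j ∈ Finset.Iio i, g j = ∏ k ∈ Finset.range i, g k := by
  have := Finset.prod_map (Finset.Iio i) Fin.valEmbedding g
  rw [Fin.map_valEmbedding_Iio, Nat.Iio_eq_range] at this
  exact this.symm

theorem prod_Ioc_zero_fin {M : Type*} [CommMonoid M] {d : ℕ} (g : ℕ → M) (i : Fin (d + 1)) :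
    ∏ j ∈ Finset.Ioc 0 i, g j = ∏ k ∈ Finset.range i, g (k + 1) := by
  have := Finset.prod_map (Finset.Ioc 0 i) Fin.valEmbedding g
  rw [Fin.map_valEmbedding_Ioc] at this
  refine this.symm.trans ?_
  rw [Finset.range_eq_Ico, Finset.prod_Ico_add' g 0 i 1]
  refine Finset.prod_congr (Finset.ext fun k => ?_) fun _ _ => rfl
  simp only [Finset.mem_Ioc, Finset.mem_Ico, Fin.val_zero]
  omega

theorem prod_Ioi_fin {M : Type*} [CommMonoid M] {d : ℕ} (g : ℕ → M) (i : Fin (d + 1)) :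
    ∏ j ∈ Finset.Ioi i, g j = ∏ k ∈ Finset.Ico (i : ℕ) d, g (k + 1) := by
  have := Finset.prod_map (Finset.Ioi i) Fin.valEmbedding g
  rw [Fin.map_valEmbedding_Ioi] at this
  refine this.symm.trans ?_
  rw [Finset.prod_Ico_add' g i d 1]
  refine Finset.prod_congr (Finset.ext fun k => ?_) fun _ _ => rfl
  simp only [Finset.mem_Ioo, Finset.mem_Ico]
  omega

/-- The sum of the E i fixes every eigenspace, and these span V, so the sum is 1; then A is the
combination of the E i with coefficients θ i. -/
theorem IsStandardIdempotents.isIdempotentSystem {F V : Type*} [Field F] [AddCommGroup V]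
    [Module F V] {A B : Module.End F V} {d : ℕ} {E : Fin (d + 1) → Module.End F V}
    (h : IsStandardIdempotents A B E) (hdiag : IsDiagonalizableEnd A) {θ : Fin (d + 1) → F}
    (hθ : ∀ i, LinearMap.range (E i) = A.eigenspace (θ i)) :
    IsIdempotentSystem A B d (extendZero E) (extendZero θ) := by
  have hss : ∀ i, E i * E i = E i := fun i =>
    LinearMap.ext fun v => h.apply_self i _ (LinearMap.mem_range_self _ _)
  have hne : ∀ i j, i ≠ j → E i * E j = 0 := fun i j hij =>
    LinearMap.ext fun v => h.apply_of_ne i j hij.symm _ (LinearMap.mem_range_self _ _)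
  have hA : ∀ i, A * E i = θ i • E i := fun i => LinearMap.ext fun v => by
    have : E i v ∈ A.eigenspace (θ i) := hθ i ▸ LinearMap.mem_range_self _ _
    exact Module.End.mem_eigenspace_iff.1 this
  have hsum : ∑ i, E i = 1 := by
    have htop : ⊤ ≤ LinearMap.eqLocus (∑ i, E i) 1 := by
      rw [← hdiag]
      refine sSup_le fun U hU => ?_
      obtain ⟨j, rfl⟩ := (h.standard.1.2 U).1 hU
      rintro _ ⟨v, rfl⟩
      rw [LinearMap.mem_eqLocus, ← Module.End.mul_apply, Finset.sum_mul,
        Finset.sum_eq_single_of_mem j (Finset.mem_univ _) fun i _ hij => hne i j hij, hss]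
      rfl
    exact LinearMap.ext fun v => htop trivial
  have hA' : ∀ i, E i * A = θ i • E i := fun i => by
    have : A = ∑ j, θ j • E j := by
      rw [← mul_one A, ← hsum, Finset.mul_sum]
      exact Finset.sum_congr rfl fun j _ => hA j
    rw [this, Finset.mul_sum, Finset.sum_eq_single_of_mem i (Finset.mem_univ _), mul_smul_comm, hss]
    intro j _ hj
    rw [mul_smul_comm, hne i j hj.symm, smul_zero]
  have htri : ∀ i j : Fin (d + 1), (i : ℕ) + 1 < j ∨ (j : ℕ) + 1 < i → E i * B * E j = 0 := by
    intro i j hij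
    refine LinearMap.ext fun v => ?_
    have h1 : B (E j v) ∈ (LinearMap.range (E j)).map B :=
      ⟨E j v, LinearMap.mem_range_self _ _, rfl⟩
    have h2 := h.standard.2 j h1
    have h3 : (⨆ k : {k : Fin (d + 1) // (k : ℕ) ≤ (j : ℕ) + 1 ∧ (j : ℕ) ≤ (k : ℕ) + 1},
        LinearMap.range (E k)) ≤ LinearMap.ker (E i) := by
      refine iSup_le ?_
      rintro ⟨k, hk⟩
      rintro _ ⟨u, rfl⟩
      refine h.apply_of_ne i k ?_ _ (LinearMap.mem_range_self _ _)
      rintro rfl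
      omega
    exact h3 h2
  have lift : ∀ (p : ℕ → Prop), (∀ i : Fin (d + 1), p i) → (∀ k, d < k → p k) → ∀ k, p k := by
    intro p h1 h2 k
    by_cases hk : d < k
    · exact h2 k hk
    · exact h1 ⟨k, by omega⟩
  refine ⟨?_, ?_, ?_, ?_, ?_, ?_, fun k hk => extendZero_of_lt _ hk, ?_, ?_⟩
  · rw [Finset.sum_range, ← hsum]
    exact Finset.sum_congr rfl fun i _ => extendZero_val E i
  · refine lift _ (fun i => ?_) fun k hk => ?_
    · rw [extendZero_val, hss]
    · rw [extendZero_of_lt _ hk, mul_zero]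
  · intro i j hij
    by_cases hi : d < i
    · rw [extendZero_of_lt _ hi, zero_mul]
    by_cases hj : d < j
    · rw [extendZero_of_lt E hj, mul_zero]
    rw [extendZero_of_le E (by omega), extendZero_of_le E (by omega)]
    exact hne _ _ fun he => hij (congrArg Fin.val he)
  · refine lift _ (fun i => ?_) fun k hk => ?_
    · rw [extendZero_val, extendZero_val, hA]
    · rw [extendZero_of_lt _ hk, mul_zero, smul_zero]
  · refine lift _ (fun i => ?_) fun k hk => ?_
    · rw [extendZero_val, extendZero_val, hA']
    · rw [extendZero_of_lt _ hk, zero_mul, smul_zero]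
  · intro k hk h0
    rw [extendZero_of_le E hk] at h0
    refine ((h.standard.1.2 _).2 ⟨⟨k, Nat.lt_succ_of_le hk⟩, rfl⟩).1 ?_
    change LinearMap.range (E _) = ⊥
    rw [h0, LinearMap.range_zero]
  · intro i j hi hj hij
    rw [extendZero_of_le θ hi, extendZero_of_le θ hj] at hij
    have : (⟨i, Nat.lt_succ_of_le hi⟩ : Fin (d + 1)) = ⟨j, Nat.lt_succ_of_le hj⟩ :=
      h.standard.1.1 ((hθ _).trans (hij ▸ (hθ _).symm))
    exact congrArg Fin.val this
  · intro i j hij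
    by_cases hi : d < i
    · rw [extendZero_of_lt _ hi, zero_mul, zero_mul]
    by_cases hj : d < j
    · rw [extendZero_of_lt E hj, mul_zero]
    rw [extendZero_of_le E (by omega), extendZero_of_le E (by omega)]
    exact htri _ _ hij

/-! ### Sharpness and bases of tridiagonal systems. -/

namespace TridiagonalSystem

variable {F V : Type*} [Field F] [AddCommGroup V] [Module F V] {d : ℕ}

theorem isIdempotentSystem (Φ : TridiagonalSystem F V d) :
    IsIdempotentSystem Φ.A Φ.Astar d (extendZero Φ.E) (extendZero Φ.eigenvalue) :=
  Φ.standard.isIdempotentSystem Φ.pair.diag Φ.range_eq_eigenspace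

theorem isIdempotentSystem_star (Φ : TridiagonalSystem F V d) :
    IsIdempotentSystem Φ.Astar Φ.A d (extendZero Φ.Estar) (extendZero Φ.dualEigenvalue) :=
  Φ.star.isIdempotentSystem

theorem eigenvalue_eq (Φ Ψ : TridiagonalSystem F V d) (hA : Ψ.A = Φ.A) {i j : Fin (d + 1)}
    (hE : Ψ.E i = Φ.E j) : Ψ.eigenvalue i = Φ.eigenvalue j := by
  have h1 := Ψ.isIdempotentSystem.left_mul i
  have h2 := Φ.isIdempotentSystem.left_mul j
  have h3 := Φ.isIdempotentSystem.ne_zero j (Nat.le_of_lt_succ j.isLt)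
  simp only [extendZero_val] at h1 h2 h3
  rw [hA, hE, h2] at h1
  exact (smul_left_injective F h3 h1).symm

theorem star_eigenvalue (Φ : TridiagonalSystem F V d) : Φ.star.eigenvalue = Φ.dualEigenvalue := rfl

theorem star_dualEigenvalue (Φ : TridiagonalSystem F V d) :
    Φ.star.dualEigenvalue = Φ.eigenvalue := rfl

theorem ddown_eigenvalue (Φ : TridiagonalSystem F V d) :
    Φ.ddown.eigenvalue = fun i => Φ.eigenvalue (Fin.rev i) :=
  funext fun _ => eigenvalue_eq Φ Φ.ddown rfl rfl

theorem ddown_dualEigenvalue (Φ : TridiagonalSystem F V d) :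
    Φ.ddown.dualEigenvalue = Φ.dualEigenvalue :=
  funext fun _ => eigenvalue_eq Φ.star Φ.ddown.star rfl rfl

theorem extendZero_ddown_E (Φ : TridiagonalSystem F V d) {k : ℕ} (hk : k ≤ d) :
    extendZero Φ.ddown.E k = extendZero Φ.E (d - k) :=
  extendZero_rev Φ.E hk

theorem finrank_E_zero (Φ : TridiagonalSystem F V d) :
    Module.finrank F (LinearMap.range (Φ.E 0)) = Module.finrank F (LinearMap.range (Φ.Estar 0)) := by
  have := Φ.isIdempotentSystem.finrank_range_zero Φ.isIdempotentSystem_star Φ.pair.irreducible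
  rwa [extendZero_zero, extendZero_zero] at this

theorem IsSharp.star {Φ : TridiagonalSystem F V d} (h : Φ.IsSharp) : Φ.star.IsSharp :=
  Φ.finrank_E_zero.symm.trans h

theorem IsSharp.ddown {Φ : TridiagonalSystem F V d} (h : Φ.IsSharp) : Φ.ddown.IsSharp :=
  Φ.ddown.finrank_E_zero.trans h.star

/-- The injectivity of `E d` on E*₀V required here is that of `E 0` for `Φ.ddown`. -/
theorem dual_mul_pow_mul_ne_zero (Φ : TridiagonalSystem F V d) {i n : ℕ} (hin : i + n ≤ d) :
    extendZero Φ.Estar (i + n) * Φ.A ^ n * extendZero Φ.Estar i ≠ 0 := by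
  refine Φ.isIdempotentSystem.dual_mul_pow_mul_ne_zero Φ.isIdempotentSystem_star
    Φ.pair.irreducible ?_ hin
  intro v hv h0
  refine Φ.ddown.isIdempotentSystem.injOn_dual_range Φ.ddown.isIdempotentSystem_star
    Φ.pair.irreducible hv ?_
  rwa [Φ.extendZero_ddown_E (Nat.zero_le d)]

theorem E_zero_mul_Estar_zero_ne_zero (Φ : TridiagonalSystem F V d) :
    extendZero Φ.E 0 * extendZero Φ.Estar 0 ≠ 0 := by
  intro h0
  refine Φ.isIdempotentSystem_star.ne_zero 0 (Nat.zero_le d) (LinearMap.ext fun v => ?_)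
  exact Φ.isIdempotentSystem.injOn_dual_range Φ.isIdempotentSystem_star Φ.pair.irreducible
    (Φ.isIdempotentSystem_star.apply_self_apply 0 v) (congrArg (fun f => f v) h0)

theorem isBase_iff (Φ : TridiagonalSystem F V d) (β : F) :
    Φ.IsBase β ↔ (∀ k, k + 3 ≤ d →
      extendZero Φ.eigenvalue k - extendZero Φ.eigenvalue (k + 3) =
        (β + 1) * (extendZero Φ.eigenvalue (k + 1) - extendZero Φ.eigenvalue (k + 2)) ∧
      extendZero Φ.dualEigenvalue k - extendZero Φ.dualEigenvalue (k + 3) =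
        (β + 1) * (extendZero Φ.dualEigenvalue (k + 1) - extendZero Φ.dualEigenvalue (k + 2))) ∧
      (d ≤ 2 → β ≠ 0) := by
  have key : ∀ (Ψ : TridiagonalSystem F V d) (k : ℕ) (hk : k + 3 ≤ d),
      (Ψ.eigenvalue ⟨k, by omega⟩ - Ψ.eigenvalue ⟨k + 3, by omega⟩) /
        (Ψ.eigenvalue ⟨k + 1, by omega⟩ - Ψ.eigenvalue ⟨k + 2, by omega⟩) = β + 1 ↔
      extendZero Ψ.eigenvalue k - extendZero Ψ.eigenvalue (k + 3) =
        (β + 1) * (extendZero Ψ.eigenvalue (k + 1) - extendZero Ψ.eigenvalue (k + 2)) := by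
    intro Ψ k hk
    have hne : extendZero Ψ.eigenvalue (k + 1) - extendZero Ψ.eigenvalue (k + 2) ≠ 0 := fun h => by
      have := Ψ.isIdempotentSystem.inj _ _ (by omega) (by omega) (sub_eq_zero.1 h)
      omega
    rw [← div_eq_iff hne, extendZero_of_le _ (by omega), extendZero_of_le _ (by omega),
      extendZero_of_le _ (by omega), extendZero_of_le _ (by omega)]
  unfold IsBase
  refine and_congr_left fun _ => forall_congr' fun k => forall_congr' fun hk => ?_
  exact and_congr (key Φ k hk) (key Φ.star k hk)

theorem exists_isBase (Φ : TridiagonalSystem F V d) : ∃ β : F, Φ.IsBase β := by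
  by_cases hd : 3 ≤ d
  · obtain ⟨β, hβ⟩ := Φ.isIdempotentSystem.exists_base Φ.isIdempotentSystem_star
      (fun i n hin => Φ.dual_mul_pow_mul_ne_zero hin) hd
    exact ⟨β, (Φ.isBase_iff β).2 ⟨hβ, fun h => absurd hd (by omega)⟩⟩
  · exact ⟨1, (Φ.isBase_iff 1).2 ⟨fun k hk => absurd hk (by omega), fun _ => one_ne_zero⟩⟩

theorem IsBase.star {Φ : TridiagonalSystem F V d} {β : F} (h : Φ.IsBase β) : Φ.star.IsBase β :=
  ⟨fun k hk => (h.1 k hk).symm, h.2⟩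

theorem IsBase.ddown {Φ : TridiagonalSystem F V d} {β : F} (h : Φ.IsBase β) : Φ.ddown.IsBase β := by
  rw [isBase_iff] at h ⊢
  refine ⟨fun k hk => ⟨?_, ?_⟩, h.2⟩
  · rw [ddown_eigenvalue, extendZero_rev _ (by omega), extendZero_rev _ (by omega),
      extendZero_rev _ (by omega), extendZero_rev _ (by omega)]
    obtain ⟨m, rfl⟩ := Nat.exists_eq_add_of_le hk
    have := (h.1 m (by omega)).1
    rw [show k + 3 + m - k = m + 3 by omega, show k + 3 + m - (k + 3) = m by omega,
      show k + 3 + m - (k + 1) = m + 2 by omega, show k + 3 + m - (k + 2) = m + 1 by omega]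
    linear_combination -this
  · rw [ddown_dualEigenvalue]
    exact (h.1 k hk).2

end TridiagonalSystem

/-! ### Two combinatorial lemmas. -/

theorem prod_range_two_mul {M : Type*} [CommMonoid M] (g : ℕ → M) (m : ℕ) :
    ∏ k ∈ Finset.range (2 * m), g k = ∏ j ∈ Finset.range m, (g (2 * j) * g (2 * j + 1)) := by
  induction m with
  | zero => simp
  | succ m ih =>
    rw [show 2 * (m + 1) = 2 * m + 1 + 1 by ring, Finset.prod_range_succ, Finset.prod_range_succ, ih,
      Finset.prod_range_succ, mul_assoc]

/-- An injective walk on the path 0, …, d cannot turn back, so its first step fixes the direction.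
-/
theorem eq_self_or_eq_sub_of_path {d : ℕ} {σ : ℕ → ℕ} (hle : ∀ k ≤ d, σ k ≤ d)
    (hinj : ∀ i ≤ d, ∀ j ≤ d, σ i = σ j → i = j)
    (hpath : ∀ k, k + 1 ≤ d → σ (k + 1) ≤ σ k + 1 ∧ σ k ≤ σ (k + 1) + 1) :
    (∀ k ≤ d, σ k = k) ∨ ∀ k ≤ d, σ k = d - k := by
  rcases Nat.eq_zero_or_pos d with rfl | hd
  · left
    intro k hk
    have := hle k hk
    omega
  have h01 : σ 0 ≠ σ 1 := fun h => by
    have := hinj 0 (Nat.zero_le _) 1 hd h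
    omega
  have h1 := hpath 0 hd
  rw [zero_add] at h1
  have hstep : ∀ k, k + 2 ≤ d → σ (k + 2) ≠ σ k ∧ σ (k + 2) ≠ σ (k + 1) := fun k hk => by
    constructor
    · intro h
      have := hinj _ hk _ (by omega) h
      omega
    · intro h
      have := hinj _ hk _ (by omega) h
      omega
  obtain hup | hdown : σ 1 = σ 0 + 1 ∨ σ 0 = σ 1 + 1 := by omega
  · left
    have hall : ∀ k, k + 1 ≤ d → σ k = σ 0 + k ∧ σ (k + 1) = σ 0 + (k + 1) := by
      intro k
      induction k with
      | zero => intro _; exact ⟨rfl, hup⟩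
      | succ k ih =>
        intro hk
        obtain ⟨e1, e2⟩ := ih (by omega)
        have h2 := hpath (k + 1) hk
        have h3 := hstep k hk
        rw [show k + 1 + 1 = k + 2 from rfl] at *
        refine ⟨e2, ?_⟩
        omega
    have hd' := (hall (d - 1) (by omega)).2
    have hdd := hle d le_rfl
    rw [Nat.sub_add_cancel hd] at hd'
    intro k hk
    rcases Nat.eq_zero_or_pos k with rfl | hk0
    · omega
    · have := (hall (k - 1) (by omega)).2
      rw [Nat.sub_add_cancel hk0] at this
      omega
  · right
    have hall : ∀ k, k + 1 ≤ d → σ k + k = σ 0 ∧ σ (k + 1) + (k + 1) = σ 0 := by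
      intro k
      induction k with
      | zero => intro _; exact ⟨rfl, hdown.symm⟩
      | succ k ih =>
        intro hk
        obtain ⟨e1, e2⟩ := ih (by omega)
        have h2 := hpath (k + 1) hk
        have h3 := hstep k hk
        rw [show k + 1 + 1 = k + 2 from rfl] at *
        refine ⟨e2, ?_⟩
        omega
    have hd' := (hall (d - 1) (by omega)).2
    have hdd := hle 0 (Nat.zero_le d)
    rw [Nat.sub_add_cancel hd] at hd'
    intro k hk
    rcases Nat.eq_zero_or_pos k with rfl | hk0
    · omega
    · have := (hall (k - 1) (by omega)).2
      rw [Nat.sub_add_cancel hk0] at this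
      omega

/-! ### Invariance of the Drinfel'd polynomial. -/

namespace TridiagonalSystem

variable {F V : Type*} [Field F] [AddCommGroup V] [Module F V] {d : ℕ}

theorem splitSpace_zero (Φ : TridiagonalSystem F V d) :
    Φ.splitSpace 0 = LinearMap.range (Φ.Estar 0) := by
  have h1 : (⨆ j : Set.Iic (0 : Fin (d + 1)), LinearMap.range (Φ.Estar j)) =
      LinearMap.range (Φ.Estar 0) := by
    refine le_antisymm (iSup_le ?_)
      (le_iSup (fun j : Set.Iic (0 : Fin (d + 1)) => LinearMap.range (Φ.Estar j)) ⟨0, Set.mem_Iic.2 le_rfl⟩)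
    rintro ⟨j, hj⟩
    obtain rfl : j = 0 := le_antisymm hj (Fin.zero_le j)
    exact le_rfl
  have h2 : (⨆ j : Set.Ici (0 : Fin (d + 1)), LinearMap.range (Φ.E j)) = ⊤ := by
    refine top_le_iff.1 fun v _ => ?_
    rw [← Φ.isIdempotentSystem.sum_apply v, Finset.sum_range]
    refine sum_mem fun i _ => ?_
    rw [extendZero_val]
    exact le_iSup (fun j : Set.Ici (0 : Fin (d + 1)) => LinearMap.range (Φ.E j))
      ⟨i, Fin.zero_le i⟩ (LinearMap.mem_range_self _ v)
  rw [splitSpace, h1, h2, inf_top_eq]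

theorem splitMap_eq (Φ : TridiagonalSystem F V d) (i : Fin (d + 1)) :
    Φ.splitMap i =
      aeval Φ.Astar (∏ j ∈ Finset.range i, (X - C (extendZero Φ.dualEigenvalue (j + 1)))) *
      aeval Φ.A (∏ j ∈ Finset.range i, (X - C (extendZero Φ.eigenvalue j))) := by
  rw [splitMap, ← prod_Ioc_zero_fin (fun k => X - C (extendZero Φ.dualEigenvalue k)),
    ← prod_Iio_fin (fun k => X - C (extendZero Φ.eigenvalue k))]
  simp only [extendZero_val]

theorem isSplitSequence_iff (Φ : TridiagonalSystem F V d) (ζ : Fin (d + 1) → F) :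
    Φ.IsSplitSequence ζ ↔ ∀ i, Φ.splitMap i * Φ.Estar 0 = ζ i • Φ.Estar 0 := by
  unfold IsSplitSequence
  refine forall_congr' fun i => ?_
  rw [splitSpace_zero]
  constructor
  · intro h
    exact LinearMap.ext fun v => h _ (LinearMap.mem_range_self _ v)
  · rintro h _ ⟨v, rfl⟩
    exact congrArg (fun f => f v) h

theorem splitMap_mul (Φ : TridiagonalSystem F V d) (i : Fin (d + 1)) :
    Φ.splitMap i * Φ.Estar 0 =
      (∏ j ∈ Finset.range i,
        (extendZero Φ.dualEigenvalue 0 - extendZero Φ.dualEigenvalue (j + 1))) •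
      (Φ.Estar 0 * aeval Φ.A (∏ j ∈ Finset.range i, (X - C (extendZero Φ.eigenvalue j))) *
        Φ.Estar 0) := by
  have := Φ.isIdempotentSystem_star.dual_splitMap_mul i (extendZero Φ.eigenvalue)
  rwa [← splitMap_eq, extendZero_zero Φ.Estar] at this

theorem Estar_zero_ne_zero (Φ : TridiagonalSystem F V d) : Φ.Estar 0 ≠ 0 := by
  have := Φ.isIdempotentSystem_star.ne_zero 0 (Nat.zero_le d)
  rwa [extendZero_zero] at this

theorem IsSharp.exists_Estar_mul_mul {Φ : TridiagonalSystem F V d} (h : Φ.IsSharp)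
    (Z : Module.End F V) : ∃ c : F, Φ.Estar 0 * Z * Φ.Estar 0 = c • Φ.Estar 0 :=
  exists_mul_mul_eq_smul h.star Z

theorem IsSharp.existsUnique_isSplitSequence {Φ : TridiagonalSystem F V d} (h : Φ.IsSharp) :
    ∃! ζ : Fin (d + 1) → F, Φ.IsSplitSequence ζ := by
  have hex : ∀ i, ∃ c : F, Φ.splitMap i * Φ.Estar 0 = c • Φ.Estar 0 := by
    intro i
    obtain ⟨c, hc⟩ := h.exists_Estar_mul_mul
      (aeval Φ.A (∏ j ∈ Finset.range i, (X - C (extendZero Φ.eigenvalue j))))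
    exact ⟨_, by rw [splitMap_mul, hc, smul_smul]⟩
  choose ζ hζ using hex
  refine ⟨ζ, (Φ.isSplitSequence_iff ζ).2 hζ, fun ξ hξ => funext fun i => ?_⟩
  have h1 := (Φ.isSplitSequence_iff ξ).1 hξ i
  rw [hζ] at h1
  exact (smul_left_injective F Φ.Estar_zero_ne_zero h1).symm

theorem IsSharp.splitMap_mul_Estar {Φ : TridiagonalSystem F V d} (h : Φ.IsSharp)
    (i : Fin (d + 1)) : Φ.splitMap i * Φ.Estar 0 = Φ.splitSeq i • Φ.Estar 0 :=
  (Φ.isSplitSequence_iff _).1 (Classical.epsilon_spec h.existsUnique_isSplitSequence.exists) i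

theorem IsSharp.splitSeq_star {Φ : TridiagonalSystem F V d} (h : Φ.IsSharp) :
    Φ.star.splitSeq = Φ.splitSeq := by
  funext i
  have h1 := h.splitMap_mul_Estar i
  have h2 := h.star.splitMap_mul_Estar i
  rw [splitMap_eq, ← extendZero_zero Φ.Estar] at h1
  rw [splitMap_eq, ← extendZero_zero Φ.star.Estar] at h2
  exact (Φ.isIdempotentSystem.splitMap_eigenvalue_dual Φ.isIdempotentSystem_star
    Φ.E_zero_mul_Estar_zero_ne_zero h1 h2).symm

/-- Expand the polynomial in A over the idempotents. The scalar m j depends on `E j` alone and not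
on the ordering, so `⇓` only reindexes the m j. -/
theorem IsSharp.splitSeq_eq {Φ : TridiagonalSystem F V d} (h : Φ.IsSharp) {m : ℕ → F}
    (hm : ∀ j ≤ d, Φ.Estar 0 * extendZero Φ.E j * Φ.Estar 0 = m j • Φ.Estar 0) (i : Fin (d + 1)) :
    Φ.splitSeq i = (∏ j ∈ Finset.range i,
        (extendZero Φ.dualEigenvalue 0 - extendZero Φ.dualEigenvalue (j + 1))) *
      ∑ j ∈ Finset.range (d + 1), m j * ∏ k ∈ Finset.range i,
        (extendZero Φ.eigenvalue j - extendZero Φ.eigenvalue k) := by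
  refine smul_left_injective F Φ.Estar_zero_ne_zero ?_
  change Φ.splitSeq i • Φ.Estar 0 = _ • Φ.Estar 0
  rw [← h.splitMap_mul_Estar, splitMap_mul, mul_smul, Φ.isIdempotentSystem.aeval_eq_sum,
    Finset.mul_sum, Finset.sum_mul, Finset.sum_smul]
  congr 1
  refine Finset.sum_congr rfl fun j hj => ?_
  rw [mul_smul_comm, smul_mul_assoc, hm j (Nat.le_of_lt_succ (Finset.mem_range.1 hj)), smul_smul,
    mul_comm, eval_prod]
  simp only [eval_sub, eval_X, eval_C]

theorem drinfeldPoly_of_ne (Φ : TridiagonalSystem F V d) {β : F}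
    (h : tridiagonalType d β ≠ .IIIplus) : Φ.drinfeldPoly β =
      ∑ i : Fin (d + 1), C (Φ.splitSeq i) * ∏ j ∈ Finset.Ioi i, Φ.drinfeldFactor β j := by
  unfold drinfeldPoly
  split
  · exact absurd ‹_› h
  · rfl

theorem drinfeldPoly_of_eq (Φ : TridiagonalSystem F V d) {β : F}
    (h : tridiagonalType d β = .IIIplus) : Φ.drinfeldPoly β =
      ∏ i ∈ Finset.Ioi (0 : Fin (d + 1)), Φ.drinfeldFactorIIIplus i := by
  unfold drinfeldPoly
  rw [h]

theorem drinfeldFactor_star (Φ : TridiagonalSystem F V d) (β : F) :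
    Φ.star.drinfeldFactor β = Φ.drinfeldFactor β := by
  funext i
  unfold drinfeldFactor
  rw [star_eigenvalue, star_dualEigenvalue, mul_comm (Φ.dualEigenvalue 0),
    mul_comm (Φ.dualEigenvalue (Fin.last d)), add_comm (_ * _) (_ * _),
    mul_comm (Φ.dualEigenvalue 0 - _)]

theorem drinfeldFactorIIIplus_star (Φ : TridiagonalSystem F V d) :
    Φ.star.drinfeldFactorIIIplus = Φ.drinfeldFactorIIIplus := by
  funext i
  unfold drinfeldFactorIIIplus
  rw [star_eigenvalue, star_dualEigenvalue, mul_comm (Φ.dualEigenvalue 0),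
    mul_comm (Φ.dualEigenvalue (Fin.last d)), add_comm (_ * _) (_ * _),
    mul_comm (Φ.dualEigenvalue 0 - _)]

theorem IsSharp.drinfeldPoly_star {Φ : TridiagonalSystem F V d} (h : Φ.IsSharp) (β : F) :
    Φ.star.drinfeldPoly β = Φ.drinfeldPoly β := by
  by_cases ht : tridiagonalType d β = .IIIplus
  · rw [drinfeldPoly_of_eq _ ht, drinfeldPoly_of_eq _ ht, drinfeldFactorIIIplus_star]
  · rw [drinfeldPoly_of_ne _ ht, drinfeldPoly_of_ne _ ht, drinfeldFactor_star, h.splitSeq_star]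

theorem extendZero_eigenvalue_eq_recSeq {Φ : TridiagonalSystem F V d} {β : F} (hβ : Φ.IsBase β)
    {k : ℕ} (hk : k ≤ d) : extendZero Φ.eigenvalue k =
      recSeq β (extendZero Φ.eigenvalue 0) (extendZero Φ.eigenvalue 1)
        (extendZero Φ.eigenvalue 2) k :=
  eq_recSeq β _ d (fun k hk => (((Φ.isBase_iff β).1 hβ).1 k hk).1) k hk

theorem recSeq_eigenvalue_ne {Φ : TridiagonalSystem F V d} {β : F} (hβ : Φ.IsBase β) {i j : ℕ}
    (hi : i ≤ d) (hj : j ≤ d) (hij : i ≠ j) :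
    recSeq β (extendZero Φ.eigenvalue 0) (extendZero Φ.eigenvalue 1)
        (extendZero Φ.eigenvalue 2) i ≠
      recSeq β (extendZero Φ.eigenvalue 0) (extendZero Φ.eigenvalue 1)
        (extendZero Φ.eigenvalue 2) j := by
  rw [← extendZero_eigenvalue_eq_recSeq hβ hi, ← extendZero_eigenvalue_eq_recSeq hβ hj]
  exact fun h => hij (Φ.isIdempotentSystem.inj i j hi hj h)

/-- The Drinfel'd polynomial in terms of the scalars `m j` with `E* 0 E j E* 0 = m j E* 0`. -/
theorem IsSharp.drinfeldPoly_eq_sum {Φ : TridiagonalSystem F V d} (h : Φ.IsSharp) {β : F}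
    (hβ : Φ.IsBase β) (hd : 1 ≤ d) (ht : tridiagonalType d β ≠ .IIIplus) {m : ℕ → F}
    (hm : ∀ j ≤ d, Φ.Estar 0 * extendZero Φ.E j * Φ.Estar 0 = m j • Φ.Estar 0) :
    C (recSeq β 0 1 (β + 2) d) ^ d * Φ.drinfeldPoly β =
      ∑ j ∈ Finset.range (d + 1), C (m j) *
        drinfeldSum d (fun k => C (extendZero Φ.eigenvalue k))
          (fun k => C (extendZero Φ.dualEigenvalue k)) (fun k => C (recSeq β 0 1 (β + 2) k)) X
          (C (extendZero Φ.eigenvalue j)) := by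
  obtain ⟨hS, hα⟩ := drinfeldAlpha_eq_recSeq hd (fun i j hi hj hij => recSeq_eigenvalue_ne hβ hi hj hij)
    hβ.2 ht
  set S := recSeq β 0 1 (β + 2) with hSdef
  set θ := extendZero Φ.eigenvalue with hθ
  set σ := extendZero Φ.dualEigenvalue with hσ
  have hfac : ∀ i : Fin (d + 1), C (S d) * Φ.drinfeldFactor β i =
      (C (θ 0) * C (σ d) + C (θ d) * C (σ 0) - X) * C (S i) +
        C (S d) * ((C (θ 0) - C (θ i)) * (C (σ 0) - C (σ i))) := by
    intro i
    have e1 : S d * drinfeldAlpha d β i = S i := by rw [hα]; field_simp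
    rw [← e1, drinfeldFactor, hθ, hσ, extendZero_zero, extendZero_zero, extendZero_val,
      extendZero_val, extendZero_of_le _ le_rfl, extendZero_of_le _ le_rfl]
    simp only [map_sub, map_mul, map_add]
    rw [show (⟨d, Nat.lt_succ_of_le le_rfl⟩ : Fin (d + 1)) = Fin.last d from rfl]
    ring
  have hprod : ∀ i : Fin (d + 1), C (S d) ^ (d - i) * ∏ j ∈ Finset.Ioi i, Φ.drinfeldFactor β j =
      ∏ k ∈ Finset.Ico (i : ℕ) d, ((C (θ 0) * C (σ d) + C (θ d) * C (σ 0) - X) * C (S (k + 1)) +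
        C (S d) * ((C (θ 0) - C (θ (k + 1))) * (C (σ 0) - C (σ (k + 1))))) := by
    intro i
    have hcard : (Finset.Ioi i).card = d - i := by rw [Fin.card_Ioi]; omega
    rw [← prod_Ioi_fin (fun k => (C (θ 0) * C (σ d) + C (θ d) * C (σ 0) - X) * C (S k) +
        C (S d) * ((C (θ 0) - C (θ k)) * (C (σ 0) - C (σ k)))), ← hcard,
        ← Finset.prod_const, ← Finset.prod_mul_distrib]
    exact Finset.prod_congr rfl fun j _ => hfac j
  rw [drinfeldPoly_of_ne _ ht, Finset.mul_sum]
  simp only [drinfeldSum, Finset.mul_sum]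
  rw [Finset.sum_comm, Finset.sum_range]
  refine Finset.sum_congr rfl fun i _ => ?_
  -- Of the d factors S d, i go with the product of the σ 0 - σ (k + 1) and d - i with the factors
  -- p.
  rw [← hprod i, h.splitSeq_eq hm i, Finset.prod_mul_distrib, Finset.prod_const, Finset.card_range,
    show (C (S d) : F[X]) ^ d = C (S d) ^ (i : ℕ) * C (S d) ^ (d - i) by
      rw [← pow_add, Nat.add_sub_cancel' (Nat.le_of_lt_succ i.isLt)]]
  simp only [map_mul, map_sum, map_prod, map_sub, Finset.mul_sum, Finset.sum_mul]
  refine Finset.sum_congr rfl fun j _ => ?_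
  ring

theorem ddown_eq_self (Φ : TridiagonalSystem F V 0) : Φ.ddown = Φ := by
  have : (fun i => Φ.E (Fin.rev i)) = Φ.E := funext fun i => congrArg Φ.E (Fin.ext (by
    rw [Fin.val_rev]; omega))
  cases Φ
  simp only [ddown, mk.injEq, true_and, and_true]
  exact this

theorem C_extendZero_eigenvalue {Φ : TridiagonalSystem F V d} {β : F} (hβ : Φ.IsBase β)
    {k : ℕ} (hk : k ≤ d) : C (extendZero Φ.eigenvalue k) =
      recSeq (C β : F[X]) (C (extendZero Φ.eigenvalue 0)) (C (extendZero Φ.eigenvalue 1))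
        (C (extendZero Φ.eigenvalue 2)) k :=
  (congrArg (fun x => (C x : F[X])) (extendZero_eigenvalue_eq_recSeq hβ hk)).trans
    (map_recSeq C _ _ _ _ k)

theorem drinfeldSum_ddown {Φ : TridiagonalSystem F V d} {β : F} (hβ : Φ.IsBase β) (z : F[X])
    {j : ℕ} (hj : j ≤ d) :
    drinfeldSum d (fun k => C (extendZero Φ.ddown.eigenvalue k))
        (fun k => C (extendZero Φ.ddown.dualEigenvalue k))
        (fun k => C (recSeq β 0 1 (β + 2) k)) z (C (extendZero Φ.eigenvalue j)) =
      drinfeldSum d (fun k => C (extendZero Φ.eigenvalue k))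
        (fun k => C (extendZero Φ.dualEigenvalue k))
        (fun k => C (recSeq β 0 1 (β + 2) k)) z (C (extendZero Φ.eigenvalue j)) := by
  have e1 := fun k (hk : k ≤ d) => C_extendZero_eigenvalue hβ hk
  have e2 := fun k (hk : k ≤ d) => C_extendZero_eigenvalue hβ.star hk
  have e3 : ∀ k ≤ d, C (recSeq β 0 1 (β + 2) k) = recSeq (C β : F[X]) 0 1 (C β + 2) k := by
    intro k _
    rw [map_recSeq, map_zero, map_one, map_add, map_ofNat]
  have e4 : ∀ k ≤ d, C (extendZero Φ.ddown.eigenvalue k) =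
      recSeq (C β : F[X]) (C (extendZero Φ.eigenvalue 0)) (C (extendZero Φ.eigenvalue 1))
        (C (extendZero Φ.eigenvalue 2)) (d - k) := by
    intro k hk
    rw [ddown_eigenvalue, extendZero_rev _ hk, e1 _ (Nat.sub_le d k)]
  rw [star_eigenvalue] at e2
  rw [ddown_dualEigenvalue, drinfeldSum_congr e1 e2 e3, drinfeldSum_congr e4 e2 e3, e1 j hj]
  exact (drinfeldSum_reverse _ _ _ _ _ _ _ _ j hj).symm

theorem IsSharp.drinfeldPoly_ddown_of_ne {Φ : TridiagonalSystem F V d} (h : Φ.IsSharp) {β : F}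
    (hβ : Φ.IsBase β) (hd : 1 ≤ d) (ht : tridiagonalType d β ≠ .IIIplus) :
    Φ.ddown.drinfeldPoly β = Φ.drinfeldPoly β := by
  have hS := (drinfeldAlpha_eq_recSeq hd (fun i j hi hj hij => recSeq_eigenvalue_ne hβ hi hj hij)
    hβ.2 ht).1
  choose m hm using fun j => h.exists_Estar_mul_mul (extendZero Φ.E j)
  have h1 := h.drinfeldPoly_eq_sum hβ hd ht (m := m) fun j _ => hm j
  have hm' : ∀ j ≤ d, Φ.ddown.Estar 0 * extendZero Φ.ddown.E j * Φ.ddown.Estar 0 =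
      m (d - j) • Φ.ddown.Estar 0 := by
    intro j hj
    rw [Φ.extendZero_ddown_E hj]
    exact hm (d - j)
  have h2 := h.ddown.drinfeldPoly_eq_sum hβ.ddown hd ht (m := fun j => m (d - j)) hm'
  have hC : (C (recSeq β 0 1 (β + 2) d) : F[X]) ^ d ≠ 0 := pow_ne_zero _ (C_ne_zero.2 hS)
  refine mul_left_cancel₀ hC ?_
  -- After j ↦ d - j both sums carry the same m j and the same point θ j, and the reversal identity
  -- applies term by term.
  rw [h1, h2, ← Finset.sum_range_reflect]
  refine Finset.sum_congr rfl fun j hj => ?_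
  have hj' : j ≤ d := Nat.le_of_lt_succ (Finset.mem_range.1 hj)
  have e1 : extendZero Φ.ddown.eigenvalue (d - j) = extendZero Φ.eigenvalue j := by
    rw [ddown_eigenvalue, extendZero_rev _ (Nat.sub_le d j), Nat.sub_sub_self hj']
  rw [show d + 1 - 1 - j = d - j by omega, Nat.sub_sub_self hj', e1, drinfeldSum_ddown hβ X hj']

/-- For even i, (θ 0 - θ i)(θ* 0 - θ* i) is i²/d² times (θ 0 - θ d)(θ* 0 - θ* d), so p_i is i²/d²
times θ 0 θ* 0 + θ d θ* d - λ. Paired with the preceding odd factor it gives a product of two linear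
factors that `⇓` exchanges. -/
theorem drinfeldPoly_IIIplus {Φ : TridiagonalSystem F V d} {β : F} (hβ : Φ.IsBase β) (hd : 1 ≤ d)
    (ht : tridiagonalType d β = .IIIplus) :
    ∃ n : ℕ, d = 2 * n ∧ Φ.drinfeldPoly β = ∏ j ∈ Finset.range n,
      (C (((2 * j + 1 + 1 : ℕ) : F) ^ 2 / (d : F) ^ 2) *
      ((C (Φ.eigenvalue 0 * Φ.dualEigenvalue (Fin.last d) +
        Φ.eigenvalue (Fin.last d) * Φ.dualEigenvalue 0) - X) *
      (C (Φ.eigenvalue 0 * Φ.dualEigenvalue 0 +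
        Φ.eigenvalue (Fin.last d) * Φ.dualEigenvalue (Fin.last d)) - X))) := by
  obtain ⟨rfl, heven, h2⟩ := tridiagonalType_IIIplus ht
  obtain ⟨hd0, h1⟩ := recSeq_IIIplus heven h2
    (recSeq_eigenvalue_ne hβ (Nat.zero_le d) le_rfl (by omega))
  obtain ⟨-, h1'⟩ := recSeq_IIIplus heven h2
    (recSeq_eigenvalue_ne hβ.star (Nat.zero_le d) le_rfl (by omega))
  obtain ⟨n, hn⟩ := even_iff_exists_two_mul.1 heven
  refine ⟨n, hn, ?_⟩
  have e1 : ∀ k, k ≤ d → Even k → extendZero Φ.eigenvalue 0 - extendZero Φ.eigenvalue k =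
      (k : F) / d * (extendZero Φ.eigenvalue 0 - extendZero Φ.eigenvalue d) := by
    intro k hk hev
    rw [extendZero_eigenvalue_eq_recSeq hβ hk, extendZero_eigenvalue_eq_recSeq hβ le_rfl]
    exact h1 k hev
  have e2 : ∀ k, k ≤ d → Even k → extendZero Φ.dualEigenvalue 0 - extendZero Φ.dualEigenvalue k =
      (k : F) / d * (extendZero Φ.dualEigenvalue 0 - extendZero Φ.dualEigenvalue d) := by
    intro k hk hev
    rw [← star_eigenvalue, extendZero_eigenvalue_eq_recSeq hβ.star hk,
      extendZero_eigenvalue_eq_recSeq hβ.star le_rfl]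
    exact h1' k hev
  rw [drinfeldPoly_of_eq _ ht]
  have e3 : ∏ i ∈ Finset.Ioi (0 : Fin (d + 1)), Φ.drinfeldFactorIIIplus i =
      ∏ i ∈ Finset.Ioi (0 : Fin (d + 1)), extendZero Φ.drinfeldFactorIIIplus i :=
    Finset.prod_congr rfl fun i _ => (extendZero_val _ i).symm
  rw [e3, prod_Ioi_fin (extendZero Φ.drinfeldFactorIIIplus) 0, Fin.val_zero,
    ← Finset.range_eq_Ico, Finset.prod_congr (congrArg Finset.range hn) fun _ _ => rfl,
    prod_range_two_mul]
  refine Finset.prod_congr rfl fun j hj => ?_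
  rw [Finset.mem_range] at hj
  have hle : 2 * j + 1 + 1 ≤ d := by omega
  have hev : Even (2 * j + 1 + 1) := ⟨j + 1, by ring⟩
  have f1 := e1 _ hle hev
  have f2 := e2 _ hle hev
  rw [extendZero_zero, extendZero_of_le _ hle, extendZero_of_le _ le_rfl] at f1 f2
  rw [extendZero_of_le _ (by omega), extendZero_of_le _ hle]
  unfold drinfeldFactorIIIplus
  simp only
  rw [if_neg (by simp [parity_simps]), if_pos hev, f1, f2,
    show (⟨d, Nat.lt_succ_of_le le_rfl⟩ : Fin (d + 1)) = Fin.last d from rfl]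
  have g1 : ((2 * j + 1 + 1 : ℕ) : F) / d * (Φ.eigenvalue 0 - Φ.eigenvalue (Fin.last d)) *
      (((2 * j + 1 + 1 : ℕ) : F) / d * (Φ.dualEigenvalue 0 - Φ.dualEigenvalue (Fin.last d))) =
      ((2 * j + 1 + 1 : ℕ) : F) ^ 2 / (d : F) ^ 2 *
        ((Φ.eigenvalue 0 - Φ.eigenvalue (Fin.last d)) *
          (Φ.dualEigenvalue 0 - Φ.dualEigenvalue (Fin.last d))) := by
    rw [← div_pow]; ring
  rw [g1]
  generalize ((2 * j + 1 + 1 : ℕ) : F) ^ 2 / (d : F) ^ 2 = q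
  simp only [map_add, map_sub, map_mul]
  ring

theorem IsSharp.drinfeldPoly_ddown {Φ : TridiagonalSystem F V d} (h : Φ.IsSharp) {β : F}
    (hβ : Φ.IsBase β) : Φ.ddown.drinfeldPoly β = Φ.drinfeldPoly β := by
  rcases Nat.eq_zero_or_pos d with rfl | hd
  · rw [ddown_eq_self]
  by_cases ht : tridiagonalType d β = .IIIplus
  · obtain ⟨n, hn, h1⟩ := drinfeldPoly_IIIplus hβ hd ht
    obtain ⟨n', hn', h2⟩ := drinfeldPoly_IIIplus hβ.ddown hd ht
    obtain rfl : n = n' := by omega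
    rw [h1, h2, ddown_eigenvalue, ddown_dualEigenvalue]
    refine Finset.prod_congr rfl fun j _ => ?_
    simp only [Fin.rev_zero, Fin.rev_last, map_add]
    ring
  · exact h.drinfeldPoly_ddown_of_ne hβ hd ht

theorem Relative.invariants {Φ Ψ : TridiagonalSystem F V d} (hΨ : Φ.Relative Ψ) (h : Φ.IsSharp) :
    Ψ.IsSharp ∧ ∀ β, Φ.IsBase β → Ψ.IsBase β ∧ Ψ.drinfeldPoly β = Φ.drinfeldPoly β := by
  induction hΨ with
  | refl => exact ⟨h, fun β hβ => ⟨hβ, rfl⟩⟩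
  | star _ ih =>
    refine ⟨ih.1.star, fun β hβ => ⟨(ih.2 β hβ).1.star, ?_⟩⟩
    rw [ih.1.drinfeldPoly_star, (ih.2 β hβ).2]
  | ddown _ ih =>
    refine ⟨ih.1.ddown, fun β hβ => ⟨(ih.2 β hβ).1.ddown, ?_⟩⟩
    rw [ih.1.drinfeldPoly_ddown (ih.2 β hβ).1, (ih.2 β hβ).2]
  | @down Ψ _ ih =>
    have hdown : Ψ.down = Ψ.star.ddown.star := rfl
    rw [hdown]
    refine ⟨ih.1.star.ddown.star, fun β hβ => ⟨(ih.2 β hβ).1.star.ddown.star, ?_⟩⟩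
    rw [ih.1.star.ddown.drinfeldPoly_star, ih.1.star.drinfeldPoly_ddown (ih.2 β hβ).1.star,
      ih.1.drinfeldPoly_star, (ih.2 β hβ).2]

/-! ### Systems that share a tridiagonal pair, and the theorem. -/

theorem diameter_eq {d' : ℕ} (Φ : TridiagonalSystem F V d) (Ψ : TridiagonalSystem F V d')
    (hA : Ψ.A = Φ.A) : d' = d := by
  have hrange : Set.range (fun i => LinearMap.range (Ψ.E i)) =
      Set.range fun i => LinearMap.range (Φ.E i) := by
    ext W
    rw [Set.mem_range, Set.mem_range, ← Φ.standard.standard.1.2 W, ← hA,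
      Ψ.standard.standard.1.2 W]
  have := Nat.card_congr (((Equiv.ofInjective _ Ψ.standard.standard.1.1).trans
    (Equiv.setCongr hrange)).trans (Equiv.ofInjective _ Φ.standard.standard.1.1).symm)
  simpa using this

/-- The two orderings differ by a permutation σ. The blocks E (k + 1) A* E k of `Ψ` are nonzero, so
tridiagonality for `Φ` forces σ to send neighbours to neighbours. -/
theorem E_eq_or_eq_rev (Φ Ψ : TridiagonalSystem F V d) (hA : Ψ.A = Φ.A)
    (hB : Ψ.Astar = Φ.Astar) : Ψ.E = Φ.E ∨ Ψ.E = fun i => Φ.E (Fin.rev i) := by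
  have hex : ∀ i, ∃ j, LinearMap.range (Φ.E j) = LinearMap.range (Ψ.E i) := by
    intro i
    exact (Φ.standard.standard.1.2 _).1 (hA ▸ (Ψ.standard.standard.1.2 _).2 ⟨i, rfl⟩)
  choose σ hσ using hex
  have hinj : Function.Injective σ := fun i j hij =>
    Ψ.standard.standard.1.1 ((hσ i).symm.trans (hij ▸ hσ j))
  have hE : ∀ i, Ψ.E i = Φ.E (σ i) := by
    intro i
    refine LinearMap.ext fun v => ?_
    have hmem : ∀ k, Ψ.E k v ∈ LinearMap.range (Φ.E (σ k)) := fun k =>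
      hσ k ▸ LinearMap.mem_range_self _ _
    have hv : ∑ k, Ψ.E k v = v := by
      have := Ψ.isIdempotentSystem.sum_apply v
      rw [Finset.sum_range] at this
      simpa only [extendZero_val] using this
    conv_rhs => rw [← hv]
    rw [map_sum, Finset.sum_eq_single_of_mem i (Finset.mem_univ _),
      Φ.standard.apply_self _ _ (hmem i)]
    intro k _ hk
    exact Φ.standard.apply_of_ne _ _ (hinj.ne hk) _ (hmem k)
  have hpath : ∀ k, k + 1 ≤ d →
      extendZero (fun i => (σ i : ℕ)) (k + 1) ≤ extendZero (fun i => (σ i : ℕ)) k + 1 ∧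
      extendZero (fun i => (σ i : ℕ)) k ≤ extendZero (fun i => (σ i : ℕ)) (k + 1) + 1 := by
    intro k hk
    have h1 := Ψ.star.dual_mul_pow_mul_ne_zero hk
    rw [pow_one] at h1
    change extendZero Ψ.E (k + 1) * Ψ.Astar * extendZero Ψ.E k ≠ 0 at h1
    rw [extendZero_of_le _ hk, extendZero_of_le _ (by omega), hE, hE, hB] at h1
    have h2 := mt (Φ.isIdempotentSystem.tri (σ ⟨k + 1, Nat.lt_succ_of_le hk⟩)
      (σ ⟨k, by omega⟩)) (by rwa [extendZero_val, extendZero_val])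
    rw [extendZero_of_le _ hk, extendZero_of_le _ (by omega)]
    omega
  have hle : ∀ k ≤ d, extendZero (fun i => (σ i : ℕ)) k ≤ d := by
    intro k hk
    rw [extendZero_of_le _ hk]
    exact Nat.le_of_lt_succ (σ _).isLt
  have hinj' : ∀ i ≤ d, ∀ j ≤ d, extendZero (fun i => (σ i : ℕ)) i =
      extendZero (fun i => (σ i : ℕ)) j → i = j := by
    intro i hi j hj hij
    rw [extendZero_of_le _ hi, extendZero_of_le _ hj] at hij
    exact congrArg Fin.val (hinj (Fin.ext hij))
  rcases eq_self_or_eq_sub_of_path hle hinj' hpath with h1 | h1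
  · left
    funext i
    rw [hE]
    congr 1
    have := h1 i (Nat.le_of_lt_succ i.isLt)
    rw [extendZero_val] at this
    exact Fin.ext this
  · right
    funext i
    rw [hE]
    congr 1
    have := h1 i (Nat.le_of_lt_succ i.isLt)
    rw [extendZero_val] at this
    refine Fin.ext ?_
    rw [this, Fin.val_rev]
    omega

theorem relative_of_pair_eq (Φ Ψ : TridiagonalSystem F V d) (hA : Ψ.A = Φ.A)
    (hB : Ψ.Astar = Φ.Astar) : Φ.Relative Ψ := by
  have h1 := E_eq_or_eq_rev Φ Ψ hA hB
  have h2 := E_eq_or_eq_rev Φ.star Ψ.star hB hA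
  change Ψ.Estar = Φ.Estar ∨ Ψ.Estar = fun i => Φ.Estar (Fin.rev i) at h2
  have hext : ∀ Ψ' : TridiagonalSystem F V d, Ψ.A = Ψ'.A → Ψ.E = Ψ'.E → Ψ.Astar = Ψ'.Astar →
      Ψ.Estar = Ψ'.Estar → Ψ = Ψ' := by
    intro Ψ' e1 e2 e3 e4
    cases Ψ
    cases Ψ'
    simp only [mk.injEq]
    exact ⟨e1, e2, e3, e4⟩
  rcases h1 with h1 | h1 <;> rcases h2 with h2 | h2
  · rw [hext Φ hA h1 hB h2]
    exact .refl
  · rw [hext Φ.down hA h1 hB h2]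
    exact .down .refl
  · rw [hext Φ.ddown hA h1 hB h2]
    exact .ddown .refl
  · rw [hext Φ.ddown.down hA h1 hB h2]
    exact .down (.ddown .refl)

end TridiagonalSystem

theorem theorem8 {F V : Type*} [Field F] [AddCommGroup V] [Module F V] [FiniteDimensional F V]
    [Nontrivial V] {d : ℕ} (Φ : TridiagonalSystem F V d) (hΦ : Φ.IsSharp) :
    (∃ β : F, Φ.IsBase β) ∧
    (∀ Ψ : TridiagonalSystem F V d, Φ.Relative Ψ →
      Ψ.IsSharp ∧ ∃! ζ : Fin (d + 1) → F, Ψ.IsSplitSequence ζ) ∧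
    (∀ β : F, Φ.IsBase β →
      ∀ Ψ : TridiagonalSystem F V d, Φ.Relative Ψ →
        Ψ.IsBase β ∧ Ψ.drinfeldPoly β = Φ.drinfeldPoly β) ∧
    (∀ β : F, Φ.IsBase β →
      ∀ (d' : ℕ) (Ψ : TridiagonalSystem F V d'),
        ((Ψ.A = Φ.A ∧ Ψ.Astar = Φ.Astar) ∨ (Ψ.A = Φ.Astar ∧ Ψ.Astar = Φ.A)) →
        d' = d ∧ Ψ.IsSharp ∧ Ψ.IsBase β ∧ Ψ.drinfeldPoly β = Φ.drinfeldPoly β) := by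
  refine ⟨Φ.exists_isBase, fun Ψ hΨ => ?_, fun β hβ Ψ hΨ => (hΨ.invariants hΦ).2 β hβ, ?_⟩
  · have hsharp := (hΨ.invariants hΦ).1
    exact ⟨hsharp, hsharp.existsUnique_isSplitSequence⟩
  · rintro β hβ d' Ψ (⟨hA, hB⟩ | ⟨hA, hB⟩)
    · obtain rfl := Φ.diameter_eq Ψ hA
      have h := (TridiagonalSystem.relative_of_pair_eq Φ Ψ hA hB).invariants hΦ
      exact ⟨rfl, h.1, h.2 β hβ⟩
    · obtain rfl := Φ.star.diameter_eq Ψ hA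
      have h := (TridiagonalSystem.relative_of_pair_eq Φ.star Ψ hA hB).invariants hΦ.star
      have h2 := h.2 β hβ.star
      exact ⟨rfl, h.1, h2.1, h2.2.trans (hΦ.drinfeldPoly_star β)⟩
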